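/- **Setting.** Let $E$ be a finite-dimensional real inner product space (e.g. $\mathbb{R}^{d_o}$) and $F$ a finite-dimensional real normed space (e.g. $\mathbb{R}^{d_r}$). Let $\mathcal U\subset E$ be compact and convex, $\mathcal X\subset F$ open and bounded, and $\mu$ a Borel probability measure on $F$ with $\operatorname{supp}\mu\subset\mathcal X$. Let $j:\mathcal U\times\mathcal X\to\mathbb R$ be continuous and differentiable in its first argument, with partial gradient $\nabla_1 j$ continuous on $\mathcal U\times\mathcal X$ (in particular $j\in C^1(\mathcal U\times\mathcal X)$ is allowed), and put $J(u)=\int_{\mathcal X}j(u,x)\,\mu(dx)$. Assume that $\nabla J$ is Lipschitz on $\mathcal U$ with constant $L>0$. Let $P_{\mathcal U}$ be the orthogonal projection onto $\mathcal U$, and let $$\mathcal S(J)=\{u\in\mathcal U: P_{\mathcal U}(u-t\nabla J(u))=u\text{ for some }t>0\}$$ be the set of stationary points. Let $x_0,x_1,\dots$ be independent $\mathcal X$-valued random variables with distribution $\mu$. **Weights.** Given $(u_0,x_0),\dots,(u_n,x_n)$, let $\kappa_n(v,y)$ be the smallest index $k\le n$ that minimizes $\|v-u_k\|+\|y-x_k\|$,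 and put $\alpha^{(n)}_k(v)=\nu_n(\{y:\kappa_n(v,y)=k\})$, where throughout the run $\nu_n$ is one of the following: $\mu$ (exact weights); the image of $\mu$ under the map sending $y$ to the sample among $x_0,\dots,x_n$ nearest to $y$ (smallest index in case of ties; exact hybrid weights); the empirical measure $\frac1{n+1}\sum_{i\le n}\delta_{x_i}$ (empirical weights). Set $$\tilde J_n(v)=\sum_{k=0}^n\alpha_k^{(n)}(v)\,j(u_k,x_k),\quad \tilde G_n(v)=\sum_{k=0}^n\alpha_k^{(n)}(v)\,\nabla_1j(u_k,x_k),\quad \hat J_n=\tilde J_n(u_n),\quad \hat G_n=\tilde G_n(u_n).$$ **Backtracking CSG (bCSG).** Fix $0<c_1<c_2<1$, $\eta>0$ and $T,K\in\mathbb N_0$. For $t\geq 0$ let $s_n(t)=P_{\mathcal U}(u_n-t\hat G_n)$ and consider the conditions $$\text{(SW1*)}\quad \tilde J_n(s_n(t))\le\max_{0\le k\le\min(K,n)}\hat J_{n-k}-c_1\langle\hat G_n,u_n-s_n(t)\rangle,$$ $$\text{(SW2)}\quad \langle\tilde G_n(s_n(t)),s_n(t)-u_n\rangle\ge c_2\langle\hat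 G_n,s_n(t)-u_n\rangle$$ ($K=0$ is the monotone Armijo condition). The step size $\tau_n$ is computed as follows. Start with $a=0$, $b=\infty$, $\eta_A=\infty$ and trial step $t=\eta$. Perform at most $T$ passes; in each pass: * if (SW1*) fails at $t$, set $b=t$; * otherwise, if $s_n(t)=u_n-t\hat G_n$ and (SW2) fails at $t$, set $a=\eta_A=t$; * otherwise stop the loop and return $\tau_n=t$; and, if the loop was not stopped, replace $t$ by $(a+b)/2$ if $b<\infty$ and by $2a$ otherwise. If all $T$ passes are completed without stopping, return $\tau_n=\eta_A$ if $\eta_A<\infty$, and $\tau_n=t$ otherwise. The iterates are given by a fixed $u_0\in\mathcal U$ and $u_{n+1}=P_{\mathcal U}(u_n-\tau_n\hat G_n)$. **Theorem (convergence for backtracking line search).** Assume that $T$ is chosen so large that $2^{-T}\eta<\frac2L$. 1. If $\{J(u):u\in\mathcal S(J)\}\subset\mathbb R$ has Lebesgue measure zero, then almost surely every accumulation point of $(u_n)_n$ lies in $\mathcal S(J)$, and $(J(u_n))_n$ converges. 2. If $\mathcal S(J)$ is finite, then almost surely $(u_n)_n$ converges to a point of $\mathcal S(J)$. (If $\mathcal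 U$ has empty interior, gradients are understood relative to $\mathcal U$: $\nabla_1 j$ and $\nabla J$ are any fields on $\mathcal U$ with the stated properties that represent the derivatives relative to $\mathcal U$.) -/

import Mathlib

open Filter Topology MeasureTheory ProbabilityTheory

noncomputable section

namespace CSG

variable {E F : Type*} [NormedAddCommGroup E] [InnerProductSpace ℝ E] [NormedAddCommGroup F]
  [MeasurableSpace F]

/-- The orthogonal projection `argmin_{q ∈ U} ‖v - q‖` (for `U` nonempty, closed and convex there
is exactly one minimizer, so the choice operator picks that one). -/
def proj (U : Set E) (v : E) : E :=
  Classical.epsilon fun p => p ∈ U ∧ IsMinOn (fun q => ‖v - q‖) U p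

/-- The objective function `J(u) = ∫_𝒳 j(u, x) μ(dx)`. -/
def objective (μ : Measure F) (𝒳 : Set F) (j : E → F → ℝ) (u : E) : ℝ :=
  ∫ x in 𝒳, j u x ∂μ

/-- `h` is the gradient of `f` on `U`: for every `u ∈ U`, `f` is differentiable at `u` relative
to `U` with differential `w ↦ ⟪h u, w⟫`. -/
def IsGradientOn (U : Set E) (f : E → ℝ) (h : E → E) : Prop :=
  ∀ u ∈ U, HasFDerivWithinAt f (innerSL ℝ (h u)) U u

/-- The set `𝒮(J)` of stationary points of a function on `U` with gradient `h`. -/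
def stationaryPoints (U : Set E) (h : E → E) : Set E :=
  {u | u ∈ U ∧ ∃ t : ℝ, 0 < t ∧ proj U (u - t • h u) = u}

/-! ### Integration weights

Iterations and samples are numbered from `0`, so that in iteration `n` the points
`(u 0, x 0), …, (u n, x n)` are available. -/

/-- The index `k ≤ n` for which `(u k, x k)` is nearest to `(v, y)` with respect to
`‖v - u k‖ + ‖y - x k‖`; among several such indices, the smallest. -/
def nearestIndex (u : ℕ → E) (x : ℕ → F) (n : ℕ) (v : E) (y : F) : ℕ :=
  sInf {k | k ≤ n ∧ ∀ i ≤ n, ‖v - u k‖ + ‖y - x k‖ ≤ ‖v - u i‖ + ‖y - x i‖}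

/-- The index `k ≤ n` for which `x k` is nearest to `y`; among several, the smallest. -/
def nearestSampleIndex (x : ℕ → F) (n : ℕ) (y : F) : ℕ :=
  sInf {k | k ≤ n ∧ ∀ i ≤ n, ‖y - x k‖ ≤ ‖y - x i‖}

/-- The ways to compute the integration weights: the cells of the nearest point partition are
measured with `μ`, with the image of `μ` under the map to the nearest sample, or with the
empirical measure of the samples. -/
inductive WeightRule
  | exact
  | exactHybrid
  | empirical

open Classical in
/-- The weight `α_k^{(n)}(v)` with respect to the point `v`. -/
def weight (rule : WeightRule) (μ : Measure F) (u : ℕ → E) (x : ℕ → F) (n : ℕ) (v : E)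
    (k : ℕ) : ℝ :=
  match rule with
  | .exact => μ.real {y | nearestIndex u x n v y = k}
  | .exactHybrid => ∑ i ∈ Finset.range (n + 1),
      if nearestIndex u x n v (x i) = k then μ.real {y | nearestSampleIndex x n y = i} else 0
  | .empirical => (∑ i ∈ Finset.range (n + 1),
      if nearestIndex u x n v (x i) = k then (1 : ℝ) else 0) / (n + 1)

/-- The approximation `J̃_n(v) = ∑_k α_k^{(n)}(v) j(u_k, x_k)` of `J(v)`.
The value `Ĵ_n` is `J̃_n(u_n)`. -/
def valueApprox (rule : WeightRule) (μ : Measure F) (j : E → F → ℝ) (u : ℕ → E) (x : ℕ → F)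
    (n : ℕ) (v : E) : ℝ :=
  ∑ k ∈ Finset.range (n + 1), weight rule μ u x n v k * j (u k) (x k)

/-- The approximation `G̃_n(v) = ∑_k α_k^{(n)}(v) ∇₁j(u_k, x_k)` of `∇J(v)`, where `g` is `∇₁j`.
The search direction `Ĝ_n` is `G̃_n(u_n)`. -/
def gradApprox (rule : WeightRule) (μ : Measure F) (g : E → F → E) (u : ℕ → E) (x : ℕ → F)
    (n : ℕ) (v : E) : E :=
  ∑ k ∈ Finset.range (n + 1), weight rule μ u x n v k • g (u k) (x k)

/-! ### Backtracking line search -/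

open Classical in
/-- The backtracking loop with `t` remaining passes and current values `a`, `b`, `η_A`, `η`, where
`none` stands for `∞`. `A η` says that the Armijo condition holds for the trial step size `η`, and
`W η` that the Wolfe-type condition is to be respected at `η` and is violated. -/
def backtrack (A W : ℝ → Prop) : ℕ → ℝ → Option ℝ → Option ℝ → ℝ → ℝ
  | 0, _, _, ηA, η => ηA.getD η
  | t + 1, a, b, ηA, η =>
    if ¬ A η then backtrack A W t a (some η) ηA ((a + η) / 2)
    else if W η then
      backtrack A W t η b (some η) (match b with
        | some b' => (η + b') / 2
        | none => 2 * η)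
    else η

/-- The parameters of the line search: the constants `c₁`, `c₂`, the initial step size `η`, the
maximal number `T` of refinements, and the memory `K` of the non-monotone Armijo condition
(`K = 0` is the monotone Armijo condition). -/
structure LineSearch where
  c₁ : ℝ
  c₂ : ℝ
  η : ℝ
  T : ℕ
  K : ℕ

section Step

variable (rule : WeightRule) (μ : Measure F) (U : Set E) (j : E → F → ℝ) (g : E → F → E)
  (ls : LineSearch) (u : ℕ → E) (x : ℕ → F) (n : ℕ)

/-- `s_n(t) = P_U(u_n - t Ĝ_n)`. -/
def trial (t : ℝ) : E :=
  proj U (u n - t • gradApprox rule μ g u x n (u n))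

/-- The (non-monotone) Armijo condition
`J̃_n(s_n(t)) ≤ max_{0 ≤ k ≤ min(K, n)} Ĵ_{n-k} - c₁ ⟪Ĝ_n, u_n - s_n(t)⟫`. -/
def Armijo (t : ℝ) : Prop :=
  valueApprox rule μ j u x n (trial rule μ U g u x n t) ≤
    (Finset.range (min ls.K n + 1)).sup' Finset.nonempty_range_add_one
        (fun k => valueApprox rule μ j u x (n - k) (u (n - k))) -
      ls.c₁ * inner ℝ (gradApprox rule μ g u x n (u n)) (u n - trial rule μ U g u x n t)

/-- The Wolfe-type condition `⟪G̃_n(s_n(t)), s_n(t) - u_n⟫ ≥ c₂ ⟪Ĝ_n, s_n(t) - u_n⟫`. -/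
def Wolfe (t : ℝ) : Prop :=
  inner ℝ (gradApprox rule μ g u x n (trial rule μ U g u x n t))
      (trial rule μ U g u x n t - u n) ≥
    ls.c₂ * inner ℝ (gradApprox rule μ g u x n (u n)) (trial rule μ U g u x n t - u n)

/-- The step size `τ_n` returned by the backtracking refinement started at `η` with `a = 0`,
`b = ∞`, `η_A = ∞`; the Wolfe-type condition is only respected when the projection is inactive. -/
def stepSize : ℝ :=
  backtrack (Armijo rule μ U j g ls u x n)
    (fun t => trial rule μ U g u x n t = u n - t • gradApprox rule μ g u x n (u n) ∧
      ¬ Wolfe rule μ U g ls u x n t)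
    ls.T 0 none none ls.η

end Step

/-- `u` is the sequence of iterates of the backtracking CSG method with starting point `u₀` and
sample sequence `x`: `u 0 = u₀` and `u (n + 1) = P_U(u_n - τ_n Ĝ_n)`. (The right-hand side only
involves `u 0, …, u n` and `x 0, …, x n`.) -/
def IsBacktrackingCSG (rule : WeightRule) (μ : Measure F) (U : Set E) (j : E → F → ℝ)
    (g : E → F → E) (ls : LineSearch) (u₀ : E) (x : ℕ → F) (u : ℕ → E) : Prop :=
  u 0 = u₀ ∧ ∀ n, u (n + 1) =
    proj U (u n - stepSize rule μ U j g ls u x n • gradApprox rule μ g u x n (u n))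

end CSG

end

noncomputable section

namespace CSG

/-! The probabilistic part shows that the approximations become exact along the run. Since `u n`
depends only on samples with index below `n`, the sample `X n` is independent of it, and Lévy's
conditional Borel–Cantelli lemma makes every pair (cluster point of the iterates, point of the
support) a cluster point of the pairs `(u n, X n)` (`ae_mapClusterPt_prod`). By compactness the
nearest-pair distances then tend to zero uniformly (`exists_uniform_density`). With a uniform law of
large numbers for empirical weights, the weighted sums formed at time `n` and evaluated at `u m`, `m
≥ n`, approach the integrals (`ae_eventually_sum_weight_sub_le`).

The rest is deterministic. The step sizes stay in `[η / 2 ^ T, η * 2 ^ T]`, and each one satisfies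
the Armijo condition or equals `η / 2 ^ T < 2 / L`, where the descent lemma gives the decrease
instead. So `J(u_{n+1}) ≤ max of the last values of J - c ‖u_{n+1} - u_n‖² + e_n` with `e_n → 0`
(`exists_descent_errors`).

These errors need not be summable; the null set of stationary values compensates for that. Every
interval contains a compact subinterval free of stationary values. Steps starting at values in it
are eventually bounded below, so their decrease beats the error, and the window maxima cannot cross
the subinterval upwards infinitely often. Hence they converge (`tendsto_windowMax`), which forces
the values to converge and the steps to vanish. The variational inequality of the projection then
makes all cluster points stationary; if there are only finitely many, vanishing steps prevent moving
between them. -/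

/-! ### Window maxima and null sets of values -/

/-- The largest of the last `min K n + 1` values among `a 0, …, a n`. -/
def windowMax (a : ℕ → ℝ) (K n : ℕ) : ℝ :=
  (Finset.range (min K n + 1)).sup' Finset.nonempty_range_add_one (fun k => a (n - k))

theorem le_windowMax (a : ℕ → ℝ) {K n m : ℕ} (hmn : m ≤ n) (hnm : n ≤ m + K) :
    a m ≤ windowMax a K n := by
  have h : n - m ∈ Finset.range (min K n + 1) := by simp; omega
  have := Finset.le_sup' (fun k => a (n - k)) h
  rwa [Nat.sub_sub_self hmn] at this

theorem exists_windowMax_eq (a : ℕ → ℝ) (K n : ℕ) :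
    ∃ m ≤ n, n ≤ m + K ∧ windowMax a K n = a m := by
  obtain ⟨k, hk, h⟩ := Finset.exists_mem_eq_sup' (s := Finset.range (min K n + 1))
    Finset.nonempty_range_add_one (fun k => a (n - k))
  simp only [Finset.mem_range] at hk
  exact ⟨n - k, by omega, by omega, h⟩

theorem windowMax_le (a : ℕ → ℝ) {K n : ℕ} {b : ℝ} (h : ∀ m ≤ n, n ≤ m + K → a m ≤ b) :
    windowMax a K n ≤ b := by
  obtain ⟨m, h1, h2, h3⟩ := exists_windowMax_eq a K n
  exact h3 ▸ h m h1 h2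

theorem windowMax_succ_le (a : ℕ → ℝ) {K n : ℕ} {b : ℝ} (h : windowMax a K n ≤ b)
    (h' : a (n + 1) ≤ b) : windowMax a K (n + 1) ≤ b := by
  refine windowMax_le a fun m hm hmK => ?_
  rcases Nat.lt_or_ge n m with hnm | hnm
  · obtain rfl : m = n + 1 := by omega
    exact h'
  · exact (le_windowMax a hnm (by omega)).trans h

/-- A null closed set of reals misses a nontrivial compact interval in every open interval. -/
theorem exists_Icc_disjoint_of_volume_zero {s : Set ℝ} (hs : IsClosed s) (h0 : volume s = 0)
    {a b : ℝ} (hab : a < b) :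
    ∃ a' b', a < a' ∧ a' < b' ∧ b' < b ∧ Disjoint (Set.Icc a' b') s := by
  have hne : ¬ Set.Ioo a b ⊆ s := fun h => by
    have h1 := measure_mono_null h h0
    rw [Real.volume_Ioo, ENNReal.ofReal_eq_zero] at h1
    linarith
  obtain ⟨c, hc, hcs⟩ := Set.not_subset.1 hne
  have ho : IsOpen (Set.Ioo a b \ s) := isOpen_Ioo.sdiff hs
  obtain ⟨ε, hε, hball⟩ := Metric.isOpen_iff.1 ho c ⟨hc, hcs⟩
  have hsub : Set.Icc (c - ε / 2) (c + ε / 2) ⊆ Set.Ioo a b \ s := by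
    refine Set.Subset.trans ?_ hball
    rw [Real.ball_eq_Ioo]
    exact fun z hz => ⟨by linarith [hz.1], by linarith [hz.2]⟩
  refine ⟨c - ε / 2, c + ε / 2, ?_, by linarith, ?_, ?_⟩
  · exact (hsub (Set.left_mem_Icc.2 (by linarith))).1.1
  · exact (hsub (Set.right_mem_Icc.2 (by linarith))).1.2
  · exact Set.disjoint_left.2 fun z hz => (hsub hz).2

/-! ### Non-monotone descent with vanishing errors -/

section Descent

variable {E : Type*} [NormedAddCommGroup E] {U S : Set E} {f : E → ℝ} {u : ℕ → E} {K : ℕ}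
  {c : ℝ} {e : ℕ → ℝ}

/-- Steps that start where the function value lies in a compact interval without stationary values
are eventually bounded from below. -/
theorem eventually_le_step (hU : IsCompact U) (hf : ContinuousOn f U) (huU : ∀ n, u n ∈ U)
    (hstat : ∀ φ : ℕ → ℕ, Tendsto φ atTop atTop → ∀ p, Tendsto (u ∘ φ) atTop (𝓝 p) →
      Tendsto (fun k => ‖u (φ k + 1) - u (φ k)‖) atTop (𝓝 0) → p ∈ S)
    {a b : ℝ} (hab : Disjoint (Set.Icc a b) (f '' S)) :
    ∃ δ > 0, ∀ᶠ n in atTop, f (u n) ∈ Set.Icc a b → δ ≤ ‖u (n + 1) - u n‖ := by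
  by_contra! hcon
  -- Otherwise arbitrarily short steps start in the interval; a limit point of their starting points
  -- lies in `S` and has its value in `[a, b]`.
  have hex : ∀ k : ℕ, ∃ n ≥ k, f (u n) ∈ Set.Icc a b ∧ ‖u (n + 1) - u n‖ < 1 / (k + 1 : ℝ) := by
    intro k
    obtain ⟨n, hn, h⟩ := frequently_atTop.1 (hcon (1 / (k + 1 : ℝ)) (by positivity)) k
    exact ⟨n, hn, h⟩
  choose φ hφ hφab hφs using hex
  have hφt : Tendsto φ atTop atTop := tendsto_atTop_mono hφ tendsto_id
  obtain ⟨p, hpU, ψ, hψ, hlim⟩ := hU.tendsto_subseq (fun k => huU (φ k))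
  have hpS : p ∈ S := by
    refine hstat (φ ∘ ψ) (hφt.comp hψ.tendsto_atTop) p hlim ?_
    exact (squeeze_zero (fun _ => norm_nonneg _) (fun k => (hφs k).le)
      tendsto_one_div_add_atTop_nhds_zero_nat).comp hψ.tendsto_atTop
  have hfp : Tendsto (fun k => f (u (φ (ψ k)))) atTop (𝓝 (f p)) :=
    (hf p hpU).tendsto.comp (tendsto_nhdsWithin_iff.2 ⟨hlim, Eventually.of_forall fun k => huU _⟩)
  exact Set.disjoint_left.1 hab
    (isClosed_Icc.mem_of_tendsto hfp (Eventually.of_forall fun k => hφab _)) ⟨p, hpS, rfl⟩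

theorem exists_modulus (hU : IsCompact U) (hf : ContinuousOn f U) {ε : ℝ} (hε : 0 < ε) :
    ∃ ρ > 0, ∀ v ∈ U, ∀ w ∈ U, ‖v - w‖ < ρ → |f v - f w| < ε := by
  have huc := hU.uniformContinuousOn_of_continuous hf
  obtain ⟨ρ, hρ, h⟩ := Metric.uniformContinuousOn_iff.1 huc ε hε
  exact ⟨ρ, hρ, fun v hv w hw hvw => h v hv w hw (by rwa [dist_eq_norm])⟩

/-- The window maxima of a perturbed non-monotone descent sequence converge. -/
theorem tendsto_windowMax (hU : IsCompact U) (hf : ContinuousOn f U) (huU : ∀ n, u n ∈ U)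
    (hc : 0 < c) (he : Tendsto e atTop (𝓝 0))
    (hdesc : ∀ n, f (u (n + 1)) ≤
      windowMax (fun i => f (u i)) K n - c * ‖u (n + 1) - u n‖ ^ 2 + e n)
    (hstat : ∀ φ : ℕ → ℕ, Tendsto φ atTop atTop → ∀ p, Tendsto (u ∘ φ) atTop (𝓝 p) →
      Tendsto (fun k => ‖u (φ k + 1) - u (φ k)‖) atTop (𝓝 0) → p ∈ S)
    (hSc : IsClosed (f '' S)) (hS0 : volume (f '' S) = 0) :
    ∃ ℓ, Tendsto (windowMax (fun i => f (u i)) K) atTop (𝓝 ℓ) := by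
  obtain ⟨B, hB⟩ := hU.exists_bound_of_continuousOn hf
  have hBn : ∀ n, |windowMax (fun i => f (u i)) K n| ≤ B := fun n => by
    obtain ⟨m, -, -, h⟩ := exists_windowMax_eq (fun i => f (u i)) K n
    rw [h]; exact hB _ (huU m)
  refine tendsto_of_no_upcrossings dense_univ ?_
    (isBoundedUnder_of ⟨B, fun n => (abs_le.1 (hBn n)).2⟩)
    (isBoundedUnder_of ⟨-B, fun n => (abs_le.1 (hBn n)).1⟩)
  rintro a₀ - b₀ - hab₀ ⟨hlo, hhi⟩
  obtain ⟨a, b, ha, hab, hb, hdisj⟩ := exists_Icc_disjoint_of_volume_zero hSc hS0 hab₀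
  obtain ⟨δ, hδ, hev⟩ := eventually_le_step hU hf huU hstat hdisj
  obtain ⟨ρ, hρ, hmod⟩ := exists_modulus hU hf (sub_pos.2 hab)
  -- Below this threshold a step of length at least `min δ ρ` decreases more than the error can
  -- restore.
  have he' : ∀ᶠ n in atTop, e n < c * (min δ ρ) ^ 2 :=
    he.eventually (gt_mem_nhds (by positivity))
  obtain ⟨N, hN⟩ := eventually_atTop.1 (hev.and he')
  have hstep : ∀ n ≥ N, windowMax (fun i => f (u i)) K n ≤ b →
      windowMax (fun i => f (u i)) K (n + 1) ≤ b := by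
    intro n hn hM
    refine windowMax_succ_le _ hM ?_
    obtain ⟨h1, h2⟩ := hN n hn
    have hfb : f (u n) ≤ b := (le_windowMax (fun i => f (u i)) le_rfl (by omega)).trans hM
    -- A short step cannot start in `[a, b]`, so it starts below `a`, and by the choice of `ρ` it
    -- cannot jump over `b`.
    rcases lt_or_ge ‖u (n + 1) - u n‖ (min δ ρ) with hr | hr
    · have hfa : f (u n) < a := by
        by_contra! hfa
        exact absurd (h1 ⟨hfa, hfb⟩) (not_le.2 (hr.trans_le (min_le_left _ _)))
      have := (abs_lt.1 (hmod _ (huU (n + 1)) _ (huU n) (hr.trans_le (min_le_right _ _)))).2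
      linarith
    · have h3 : (min δ ρ) ^ 2 ≤ ‖u (n + 1) - u n‖ ^ 2 := by gcongr
      have h4 := mul_le_mul_of_nonneg_left h3 hc.le
      linarith [hdesc n]
  obtain ⟨n, hn, hna⟩ := frequently_atTop.1 hlo N
  have hall : ∀ m ≥ n, windowMax (fun i => f (u i)) K m ≤ b := by
    intro m hm
    induction m, hm using Nat.le_induction with
    | base => linarith
    | succ m hm ih => exact hstep m (hn.trans hm) ih
  obtain ⟨m, hm, hmb⟩ := frequently_atTop.1 hhi n
  linarith [hall m hm]

/-- If the value at one of the next `J` iterates is near the limit of the window maxima, then so is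
the present value. -/
theorem eventually_back_le (hU : IsCompact U) (hf : ContinuousOn f U) (huU : ∀ n, u n ∈ U)
    (hc : 0 < c) (he : Tendsto e atTop (𝓝 0))
    (hdesc : ∀ n, f (u (n + 1)) ≤
      windowMax (fun i => f (u i)) K n - c * ‖u (n + 1) - u n‖ ^ 2 + e n)
    {ℓ : ℝ} (hℓ : Tendsto (windowMax (fun i => f (u i)) K) atTop (𝓝 ℓ)) (J : ℕ) :
    ∀ ε > 0, ∃ ε' > 0, ∀ᶠ n in atTop, ∀ i ≤ J, ℓ - ε' ≤ f (u (n + i)) → ℓ - ε ≤ f (u n) := by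
  induction J with
  | zero =>
    refine fun ε hε => ⟨ε, hε, Eventually.of_forall fun n i hi h => ?_⟩
    obtain rfl : i = 0 := by omega
    exact h
  | succ J ih =>
    intro ε hε
    obtain ⟨ε₁, hε₁, h₁⟩ := ih ε hε
    obtain ⟨ρ, hρ, hmod⟩ := exists_modulus hU hf (half_pos hε₁)
    -- The deficit `d`, the excess of the window maximum over `ℓ` and the error each take a third of
    -- `c * ρ ^ 2`, so the step is shorter than `ρ`. It then changes the value by less than `ε₁ /
    -- 2`; the other half pays for `d`.
    set d := min (ε₁ / 2) (c * ρ ^ 2 / 3) with hd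
    have hd0 : 0 < d := by positivity
    refine ⟨d, hd0, ?_⟩
    have hM : ∀ᶠ n in atTop, windowMax (fun i => f (u i)) K n < ℓ + c * ρ ^ 2 / 3 :=
      hℓ.eventually (gt_mem_nhds (by linarith [show 0 < c * ρ ^ 2 / 3 by positivity]))
    have he' : ∀ᶠ n in atTop, e n < c * ρ ^ 2 / 3 := he.eventually (gt_mem_nhds (by positivity))
    obtain ⟨N, hN⟩ := eventually_atTop.1 (hM.and he')
    filter_upwards [h₁, eventually_ge_atTop N] with n hn hnN i hi hfi
    rcases Nat.lt_or_ge J i with hJi | hJi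
    · obtain rfl : i = J + 1 := by omega
      refine hn J le_rfl ?_
      obtain ⟨h2, h3⟩ := hN (n + J) (by omega)
      have h4 := hdesc (n + J)
      have h5 : c * ‖u (n + J + 1) - u (n + J)‖ ^ 2 < c * ρ ^ 2 := by
        have h6 : d ≤ c * ρ ^ 2 / 3 := min_le_right _ _
        rw [← add_assoc] at hfi
        linarith
      have h7 : ‖u (n + J + 1) - u (n + J)‖ < ρ :=
        lt_of_pow_lt_pow_left₀ 2 hρ.le (lt_of_mul_lt_mul_left h5 hc.le)
      have h8 := (abs_lt.1 (hmod _ (huU _) _ (huU _) h7)).2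
      have h9 : d ≤ ε₁ / 2 := min_le_left _ _
      rw [← add_assoc] at hfi
      linarith
    · refine hn i hJi (le_trans ?_ hfi)
      have h9 : d ≤ ε₁ / 2 := min_le_left _ _
      linarith

/-- Convergence of the values and vanishing steps for a perturbed non-monotone descent sequence,
provided that the stationary values form a null set. -/
theorem tendsto_value_and_step (hU : IsCompact U) (hf : ContinuousOn f U) (huU : ∀ n, u n ∈ U)
    (hc : 0 < c) (he : Tendsto e atTop (𝓝 0))
    (hdesc : ∀ n, f (u (n + 1)) ≤
      windowMax (fun i => f (u i)) K n - c * ‖u (n + 1) - u n‖ ^ 2 + e n)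
    (hstat : ∀ φ : ℕ → ℕ, Tendsto φ atTop atTop → ∀ p, Tendsto (u ∘ φ) atTop (𝓝 p) →
      Tendsto (fun k => ‖u (φ k + 1) - u (φ k)‖) atTop (𝓝 0) → p ∈ S)
    (hSc : IsClosed (f '' S)) (hS0 : volume (f '' S) = 0) :
    (∃ ℓ, Tendsto (fun n => f (u n)) atTop (𝓝 ℓ)) ∧
      Tendsto (fun n => ‖u (n + 1) - u n‖) atTop (𝓝 0) := by
  obtain ⟨ℓ, hℓ⟩ := tendsto_windowMax hU hf huU hc he hdesc hstat hSc hS0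
  have hval : Tendsto (fun n => f (u n)) atTop (𝓝 ℓ) := by
    rw [tendsto_order]
    refine ⟨fun a ha => ?_, fun b hb => ?_⟩
    · obtain ⟨ε', hε', h⟩ := eventually_back_le hU hf huU hc he hdesc hℓ K ((ℓ - a) / 2)
        (by linarith)
      have hM : ∀ᶠ n in atTop, ℓ - ε' < windowMax (fun i => f (u i)) K n :=
        hℓ.eventually (lt_mem_nhds (by linarith))
      -- The window ending at `n + K` attains its maximum at some `m` between `n` and `n + K`;
      -- closeness to `ℓ` is carried back from `m` to `n`.
      filter_upwards [h, (tendsto_add_atTop_nat K).eventually hM] with n hn hMn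
      obtain ⟨m, hm1, hm2, hm3⟩ := exists_windowMax_eq (fun i => f (u i)) K (n + K)
      have := hn (m - n) (by omega) (by
        rw [show n + (m - n) = m by omega]; linarith)
      linarith
    · filter_upwards [hℓ.eventually (gt_mem_nhds hb)] with n hn
      exact (le_windowMax (fun i => f (u i)) le_rfl (by omega)).trans_lt hn
  refine ⟨⟨ℓ, hval⟩, ?_⟩
  have h1 : Tendsto (fun n => (windowMax (fun i => f (u i)) K n - f (u (n + 1)) + e n) / c)
      atTop (𝓝 0) := by
    simpa using ((hℓ.sub (hval.comp (tendsto_add_atTop_nat 1))).add he).div_const c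
  have h2 : Tendsto (fun n => ‖u (n + 1) - u n‖ ^ 2) atTop (𝓝 0) :=
    squeeze_zero (fun n => by positivity) (fun n => by
      rw [le_div_iff₀ hc]; linarith [hdesc n]) h1
  simpa using h2.sqrt

/-- A sequence in a compact set with vanishing steps and finitely many cluster points converges. -/
theorem exists_tendsto_of_finite_clusterPts (hU : IsCompact U) (huU : ∀ n, u n ∈ U)
    (hstep : Tendsto (fun n => ‖u (n + 1) - u n‖) atTop (𝓝 0)) (hS : S.Finite)
    (hclus : ∀ p, MapClusterPt p atTop u → p ∈ S) :
    ∃ p ∈ S, Tendsto u atTop (𝓝 p) := by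
  obtain ⟨p, hpU, hp⟩ := hU.exists_mapClusterPt_of_frequently
    (Eventually.of_forall (f := atTop) huU).frequently
  refine ⟨p, hclus p hp, ?_⟩
  obtain ⟨d, hd, hsep⟩ : ∃ d > 0, ∀ q ∈ S, q ≠ p → d ≤ dist q p := by
    have hfin : (S \ {p}).Finite := hS.subset Set.sdiff_subset
    have hmem : (S \ {p})ᶜ ∈ 𝓝 p := hfin.isClosed.isOpen_compl.mem_nhds (by simp)
    obtain ⟨d, hd, hball⟩ := Metric.mem_nhds_iff.1 hmem
    refine ⟨d, hd, fun q hq hqp => ?_⟩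
    by_contra! hlt
    exact hball hlt ⟨hq, hqp⟩
  rw [Metric.tendsto_atTop]
  intro ε₀ hε₀
  -- Passing from the ball around `p` to that around another point of `S` would bridge a distance of
  -- at least `d` with two radii and one step, each at most `d / 3` and the step strictly less.
  set ε := min ε₀ (d / 3) with hεd
  have hε : 0 < ε := by positivity
  have hnear : ∀ᶠ n in atTop, ∃ q ∈ S, dist (u n) q < ε := by
    by_contra hcon
    have hfr : ∃ᶠ n in atTop, u n ∈ U \ ⋃ q ∈ S, Metric.ball q ε := by
      refine (not_eventually.1 hcon).mono fun n hn => ⟨huU n, ?_⟩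
      simpa using hn
    obtain ⟨q, hqU, hq⟩ := (hU.diff (isOpen_biUnion fun q _ =>
      Metric.isOpen_ball)).exists_mapClusterPt_of_frequently hfr
    exact hqU.2 (Set.mem_biUnion (hclus q hq) (Metric.mem_ball_self hε))
  have hst : ∀ᶠ n in atTop, ‖u (n + 1) - u n‖ < d / 3 := hstep.eventually (gt_mem_nhds (by positivity))
  obtain ⟨N, hN⟩ := eventually_atTop.1 (hnear.and hst)
  obtain ⟨n, hn, hnp⟩ := frequently_atTop.1
    (hp.frequently (Metric.ball_mem_nhds p hε)) N
  refine ⟨n, fun m hm => lt_of_lt_of_le ?_ (min_le_left ε₀ (d / 3))⟩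
  induction m, hm using Nat.le_induction with
  | base => exact hnp
  | succ m hm ih =>
    obtain ⟨q, hqS, hq⟩ := (hN (m + 1) (by omega)).1
    have hεd' : ε ≤ d / 3 := min_le_right _ _
    by_cases hqp : q = p
    · exact hqp ▸ hq
    · have h1 := hsep q hqS hqp
      have h2 := (hN m (by omega)).2
      rw [← dist_eq_norm] at h2
      have h3 := dist_triangle4 q (u (m + 1)) (u m) p
      rw [dist_comm q (u (m + 1))] at h3
      have : dist (u m) p < ε := ih
      linarith

end Descent

/-! ### Projection and stationarity as variational inequalities -/

section Projection

variable {E : Type*} [NormedAddCommGroup E] [InnerProductSpace ℝ E] {U : Set E}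

/-- Compactness gives a minimizer and the variational inequality characterizes it; the inequalities
of two minimizers add up to `‖proj U v - p‖² ≤ 0`, so the choice operator has no freedom. -/
theorem proj_eq_iff (hU : IsCompact U) (hne : U.Nonempty) (hc : Convex ℝ U) {v p : E} :
    proj U v = p ↔ p ∈ U ∧ ∀ w ∈ U, inner ℝ (v - p) (w - p) ≤ 0 := by
  have key : ∀ p, (p ∈ U ∧ IsMinOn (fun q => ‖v - q‖) U p) ↔
      (p ∈ U ∧ ∀ w ∈ U, inner ℝ (v - p) (w - p) ≤ 0) := by
    intro p
    refine and_congr_right fun hp => ?_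
    rw [← norm_eq_iInf_iff_real_inner_le_zero hc hp]
    have : Nonempty U := ⟨⟨p, hp⟩⟩
    have hbdd : BddBelow (Set.range fun w : U => ‖v - w‖) :=
      ⟨0, Set.forall_mem_range.2 fun _ => norm_nonneg _⟩
    constructor
    · intro h
      exact le_antisymm (le_ciInf fun w => isMinOn_iff.1 h w w.2) (ciInf_le hbdd ⟨p, hp⟩)
    · intro h
      exact isMinOn_iff.2 fun w hw => h ▸ ciInf_le hbdd ⟨w, hw⟩
  have hex : ∃ p, p ∈ U ∧ IsMinOn (fun q => ‖v - q‖) U p :=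
    hU.exists_isMinOn hne (by fun_prop)
  have hspec := (key _).1 (Classical.epsilon_spec hex)
  refine ⟨fun h => h ▸ hspec, fun ⟨hp, h⟩ => ?_⟩
  have h1 := hspec.2 p hp
  have h2 := h _ hspec.1
  change inner ℝ (v - proj U v) (p - proj U v) ≤ 0 at h1
  change inner ℝ (v - p) (proj U v - p) ≤ 0 at h2
  rw [← sub_eq_zero, ← inner_self_eq_zero (𝕜 := ℝ)]
  refine le_antisymm ?_ real_inner_self_nonneg
  have h3 : inner ℝ (proj U v - p) (proj U v - p) =
      inner ℝ (v - proj U v) (p - proj U v) + inner ℝ (v - p) (proj U v - p) := by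
    rw [← neg_sub (proj U v) p, inner_neg_right, neg_add_eq_sub, ← inner_sub_left,
      sub_sub_sub_cancel_left]
  linarith

theorem proj_mem (hU : IsCompact U) (hne : U.Nonempty) (hc : Convex ℝ U) (v : E) :
    proj U v ∈ U :=
  ((proj_eq_iff hU hne hc).1 rfl).1

theorem inner_sub_proj_le_zero (hU : IsCompact U) (hne : U.Nonempty) (hc : Convex ℝ U) (v : E)
    {w : E} (hw : w ∈ U) : inner ℝ (v - proj U v) (w - proj U v) ≤ 0 :=
  ((proj_eq_iff hU hne hc).1 rfl).2 w hw

theorem continuous_proj (hU : IsCompact U) (hne : U.Nonempty) (hc : Convex ℝ U) :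
    Continuous (proj U) := by
  refine LipschitzWith.continuous (K := 1) (LipschitzWith.of_dist_le_mul fun v w => ?_)
  rw [NNReal.coe_one, one_mul, dist_eq_norm, dist_eq_norm]
  have h1 := inner_sub_proj_le_zero hU hne hc v (proj_mem hU hne hc w)
  have h2 := inner_sub_proj_le_zero hU hne hc w (proj_mem hU hne hc v)
  set p := proj U v
  set q := proj U w
  have h3 : inner ℝ (p - q) (p - q) =
      inner ℝ (v - w) (p - q) + inner ℝ (v - p) (q - p) + inner ℝ (w - q) (p - q) := by
    rw [← neg_sub p q, inner_neg_right, ← sub_eq_add_neg, ← inner_sub_left, ← inner_add_left]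
    congr 1; abel
  have h4 := real_inner_le_norm (v - w) (p - q)
  rw [real_inner_self_eq_norm_sq] at h3
  rcases (norm_nonneg (p - q)).eq_or_lt with h0 | h0
  · rw [← h0]; positivity
  · refine le_of_mul_le_mul_right ?_ h0
    nlinarith

/-- The variational inequality for a projected gradient step. -/
theorem inner_step_le (hU : IsCompact U) (hc : Convex ℝ U) {u G w : E} {t : ℝ} (hw : w ∈ U) :
    inner ℝ (u - proj U (u - t • G)) (w - proj U (u - t • G)) ≤
      t * inner ℝ G (w - proj U (u - t • G)) := by
  have h := inner_sub_proj_le_zero hU ⟨w, hw⟩ hc (u - t • G) hw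
  rw [sub_right_comm, inner_sub_left, inner_smul_left] at h
  simpa using h

/-- The step size `t > 0` is only a factor in the variational inequality, so one `t` is as good as
any other. -/
theorem mem_stationaryPoints_iff (hU : IsCompact U) (hc : Convex ℝ U) {h : E → E} {u : E} :
    u ∈ stationaryPoints U h ↔ u ∈ U ∧ ∀ v ∈ U, 0 ≤ inner ℝ (h u) (v - u) := by
  refine and_congr_right fun hu => ?_
  have key : ∀ t : ℝ, proj U (u - t • h u) = u ↔ ∀ v ∈ U, 0 ≤ t * inner ℝ (h u) (v - u) := by
    intro t
    rw [proj_eq_iff hU ⟨u, hu⟩ hc]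
    simp [hu, inner_neg_left, inner_smul_left]
  simp only [key]
  constructor
  · rintro ⟨t, ht, H⟩ v hv
    exact nonneg_of_mul_nonneg_right (H v hv) ht
  · exact fun H => ⟨1, one_pos, fun v hv => by simpa using H v hv⟩

theorem isClosed_stationaryPoints (hU : IsCompact U) (hc : Convex ℝ U) {h : E → E}
    (hh : ContinuousOn h U) : IsClosed (stationaryPoints U h) := by
  refine isClosed_of_closure_subset fun p hp => ?_
  obtain ⟨s, hs, hsp⟩ := mem_closure_iff_seq_limit.1 hp
  simp only [mem_stationaryPoints_iff hU hc] at hs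
  have hpU : p ∈ U := hU.isClosed.mem_of_tendsto hsp (Eventually.of_forall fun n => (hs n).1)
  refine (mem_stationaryPoints_iff hU hc).2 ⟨hpU, fun v hv => ?_⟩
  have h1 : Tendsto (fun n => h (s n)) atTop (𝓝 (h p)) := (hh p hpU).tendsto.comp
    (tendsto_nhdsWithin_iff.2 ⟨hsp, Eventually.of_forall fun n => (hs n).1⟩)
  exact ge_of_tendsto (h1.inner (tendsto_const_nhds.sub hsp))
    (Eventually.of_forall fun n => (hs n).2 v hv)

end Projection

/-! ### Gradients relative to a convex set -/

section Gradient

variable {E : Type*} [NormedAddCommGroup E] [InnerProductSpace ℝ E] {U : Set E} {f : E → ℝ}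
  {h h₁ h₂ : E → E}

theorem IsGradientOn.continuousOn (hf : IsGradientOn U f h) : ContinuousOn f U :=
  fun u hu => (hf u hu).continuousWithinAt

/-- Two gradients of the same function agree in the directions along the convex set `U`. -/
theorem IsGradientOn.inner_sub_eq (hc : Convex ℝ U) (hf₁ : IsGradientOn U f h₁)
    (hf₂ : IsGradientOn U f h₂) {u v w : E} (hu : u ∈ U) (hv : v ∈ U) (hw : w ∈ U) :
    inner ℝ (h₁ u) (v - w) = inner ℝ (h₂ u) (v - w) := by
  -- A relative differential is determined only on tangent directions; convexity puts `v - u` in the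
  -- tangent cone at `u`.
  have key : ∀ v ∈ U, inner ℝ (h₁ u) (v - u) = inner ℝ (h₂ u) (v - u) := fun v hv => by
    simpa using (hf₁ u hu).unique_on (hf₂ u hu)
      (mem_tangentConeAt_of_segment_subset (hc.segment_subset hu hv))
  rw [← sub_sub_sub_cancel_right v w u, inner_sub_right _ (v - u), inner_sub_right _ (v - u),
    key v hv, key w hw]

/-- The descent lemma. -/
theorem IsGradientOn.le_add_sq (hc : Convex ℝ U) (hf : IsGradientOn U f h) {L : ℝ}
    (hlip : ∀ u ∈ U, ∀ v ∈ U, ‖h u - h v‖ ≤ L * ‖u - v‖) {u v : E} (hu : u ∈ U) (hv : v ∈ U) :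
    f v ≤ f u + inner ℝ (h u) (v - u) + L / 2 * ‖v - u‖ ^ 2 := by
  set γ : ℝ → E := fun t => u + t • (v - u) with hγ
  have hmaps : Set.MapsTo γ (Set.Icc 0 1) U := fun t ht => hc.add_smul_sub_mem hu hv ht
  have hγd : ∀ t, HasDerivAt γ (v - u) t := fun t => by
    have := ((hasDerivAt_id t).smul_const (v - u)).const_add u
    rwa [one_smul] at this
  -- The quadratic bound along the segment is subtracted; the Lipschitz condition makes the
  -- derivative nonpositive, and `φ 1 ≤ φ 0` is the claim.
  set φ : ℝ → ℝ := fun t => f (γ t) - t * inner ℝ (h u) (v - u) - L / 2 * t ^ 2 * ‖v - u‖ ^ 2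
    with hφ
  have hd : ∀ t ∈ Set.Icc (0 : ℝ) 1, HasDerivWithinAt φ (inner ℝ (h (γ t)) (v - u)
      - inner ℝ (h u) (v - u) - L * t * ‖v - u‖ ^ 2) (Set.Icc 0 1) t := by
    intro t ht
    have h1 : HasDerivWithinAt (fun t => f (γ t)) (inner ℝ (h (γ t)) (v - u)) (Set.Icc 0 1) t := by
      have := (hf (γ t) (hmaps ht)).comp_hasDerivWithinAt t (hγd t).hasDerivWithinAt hmaps
      rwa [innerSL_apply_apply] at this
    have h2 : HasDerivAt (fun t : ℝ => t * inner ℝ (h u) (v - u)) (inner ℝ (h u) (v - u)) t := by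
      simpa using (hasDerivAt_id t).mul_const (inner ℝ (h u) (v - u))
    have h3 : HasDerivAt (fun t : ℝ => L / 2 * t ^ 2 * ‖v - u‖ ^ 2) (L * t * ‖v - u‖ ^ 2) t := by
      refine (((hasDerivAt_pow 2 t).const_mul (L / 2)).mul_const (‖v - u‖ ^ 2)).congr_deriv ?_
      push_cast; ring
    exact (h1.sub h2.hasDerivWithinAt).sub h3.hasDerivWithinAt
  have hanti : AntitoneOn φ (Set.Icc 0 1) := by
    refine antitoneOn_of_hasDerivWithinAt_nonpos (convex_Icc 0 1)
      (fun t ht => (hd t ht).continuousWithinAt)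
      (fun t ht => (hd t (interior_subset ht)).mono interior_subset) fun t ht => ?_
    have ht' := interior_subset ht
    have h1 := real_inner_le_norm (h (γ t) - h u) (v - u)
    rw [inner_sub_left] at h1
    have h2 := hlip _ (hmaps ht') u hu
    have h3 : ‖γ t - u‖ = t * ‖v - u‖ := by
      simp [hγ, norm_smul, abs_of_nonneg ht'.1]
    rw [h3] at h2
    have h4 := mul_le_mul_of_nonneg_right h2 (norm_nonneg (v - u))
    linarith
  have := hanti (Set.left_mem_Icc.2 zero_le_one) (Set.right_mem_Icc.2 zero_le_one) zero_le_one
  simp [hφ, hγ] at this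
  linarith

end Gradient

/-! ### The backtracking loop -/

section Backtrack

variable {A W : ℝ → Prop}

/-- Each pass at worst halves or doubles the trial step, so the invariants persist with `l` halved
and `R` doubled. -/
theorem backtrack_bounds (T : ℕ) : ∀ (a : ℝ) (b ηA : Option ℝ) (t l R : ℝ),
    0 ≤ l → 0 ≤ a → a ≤ R → (∀ s ∈ b, 0 ≤ s ∧ s ≤ R) → (∀ s ∈ ηA, l ≤ s ∧ s ≤ R) → l ≤ t → t ≤ R →
    l / 2 ^ T ≤ backtrack A W T a b ηA t ∧ backtrack A W T a b ηA t ≤ R * 2 ^ T := by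
  induction T with
  | zero =>
    intro a b ηA t l R _ _ _ _ hA h1 h2
    cases ηA with
    | none => simpa [backtrack] using ⟨h1, h2⟩
    | some s => simpa [backtrack] using hA s rfl
  | succ T ih =>
    intro a b ηA t l R hl ha haR hb hA h1 h2
    have hhalf : ∀ {z : ℝ}, l / 2 / 2 ^ T ≤ z ∧ z ≤ R * 2 * 2 ^ T →
        l / 2 ^ (T + 1) ≤ z ∧ z ≤ R * 2 ^ (T + 1) := fun h => by
      rwa [pow_succ', ← div_div, ← mul_assoc]
    have hR : 0 ≤ R := ha.trans haR
    unfold backtrack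
    split_ifs with hAt hWt
    · refine hhalf (ih _ _ _ _ (l / 2) (R * 2) (by linarith) (by linarith) (by linarith) ?_ ?_ ?_ ?_)
      · exact fun s hs => ⟨(hb s hs).1, by linarith [(hb s hs).2]⟩
      · rintro s ⟨⟩; constructor <;> linarith
      · cases b with
        | none => dsimp only; linarith
        | some s => have := (hb s rfl).1; dsimp only; linarith
      · cases b with
        | none => dsimp only; linarith
        | some s => have := (hb s rfl).2; dsimp only; linarith
    · have h2T : (1 : ℝ) ≤ 2 ^ (T + 1) := one_le_pow₀ (by norm_num)
      exact ⟨(div_le_self hl h2T).trans h1, h2.trans (le_mul_of_one_le_right hR h2T)⟩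
    · refine hhalf (ih _ _ _ _ (l / 2) (R * 2) (by linarith) ha (by linarith) ?_ ?_ ?_ ?_)
      · rintro s ⟨⟩; constructor <;> linarith
      · exact fun s hs => ⟨by linarith [(hA s hs).1], by linarith [(hA s hs).2]⟩
      · linarith
      · linarith

/-- The stored fallback only ever holds steps that passed the Armijo test, and so does a step
returned early. -/
theorem backtrack_some (T : ℕ) : ∀ (a : ℝ) (b : Option ℝ) (s t : ℝ), A s →
    A (backtrack A W T a b (some s) t) := by
  induction T with
  | zero => intro a b s t h; simpa [backtrack] using h
  | succ T ih =>
    intro a b s t h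
    unfold backtrack
    split_ifs with hAt hWt
    · exact ih _ _ _ _ hAt
    · exact hAt
    · exact ih _ _ _ _ h

/-- The accepted step size satisfies the Armijo condition, unless every trial step was halved. -/
theorem backtrack_none (T : ℕ) : ∀ (b : Option ℝ) (t : ℝ),
    A (backtrack A W T 0 b none t) ∨ backtrack A W T 0 b none t = t / 2 ^ T := by
  induction T with
  | zero => intro b t; simp [backtrack]
  | succ T ih =>
    intro b t
    unfold backtrack
    split_ifs with hAt hWt
    · exact Or.inl (backtrack_some _ _ _ _ _ hAt)
    · exact Or.inl hAt
    -- `a` and `ηA` are set together, so while `ηA` is `none` the left end is still `0` and a failed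
    -- test halves `t`.
    · rw [zero_add, pow_succ', ← div_div]
      exact ih _ _

end Backtrack

/-! ### Smoothness of the objective -/

section Objective

variable {E F H : Type*} [NormedAddCommGroup E] [NormedAddCommGroup F] [NormedAddCommGroup H]
  {U : Set E} {𝒳 S : Set F} {h : E → F → H}

/-- The open set `𝒳` gives no uniform control near its boundary; the compact set `S`, later the
support of `μ`, does. -/
theorem exists_uniform_modulus (hU : IsCompact U) (hS : IsCompact S) (hS𝒳 : S ⊆ 𝒳)
    (hh : ContinuousOn (Function.uncurry h) (U ×ˢ 𝒳)) {ε : ℝ} (hε : 0 < ε) :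
    ∃ δ > 0, ∀ v ∈ U, ∀ v' ∈ U, ∀ y ∈ S, ∀ y' ∈ S, ‖v - v'‖ + ‖y - y'‖ < δ →
      ‖h v y - h v' y'‖ < ε := by
  have huc := (hU.prod hS).uniformContinuousOn_of_continuous
    (hh.mono (Set.prod_mono_right hS𝒳))
  obtain ⟨δ, hδ, H⟩ := Metric.uniformContinuousOn_iff.1 huc ε hε
  refine ⟨δ, hδ, fun v hv v' hv' y hy y' hy' hd => ?_⟩
  rw [← dist_eq_norm]
  refine H (v, y) ⟨hv, hy⟩ (v', y') ⟨hv', hy'⟩ ?_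
  rw [Prod.dist_eq, max_lt_iff, dist_eq_norm, dist_eq_norm]
  exact ⟨by linarith [norm_nonneg (y - y')], by linarith [norm_nonneg (v - v')]⟩

variable [MeasurableSpace F] [BorelSpace F] [SecondCountableTopology F] {μ : Measure F}
  [IsProbabilityMeasure μ]

theorem integrable_section (hS : IsCompact S) (hS𝒳 : S ⊆ 𝒳) (h𝒳 : IsOpen 𝒳)
    (hμS : ∀ᵐ y ∂μ, y ∈ S) (hh : ContinuousOn (Function.uncurry h) (U ×ˢ 𝒳))
    {v : E} (hv : v ∈ U) : IntegrableOn (h v) 𝒳 μ := by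
  have hc : ContinuousOn (h v) 𝒳 :=
    hh.comp (f := fun y => (v, y)) (by fun_prop) fun y hy => ⟨hv, hy⟩
  obtain ⟨B, hB⟩ := hS.exists_bound_of_continuousOn (hc.mono hS𝒳)
  exact Integrable.of_bound (hc.aestronglyMeasurable h𝒳.measurableSet) B
    (ae_restrict_of_ae (hμS.mono hB))

variable [InnerProductSpace ℝ E] [CompleteSpace E] {j : E → F → ℝ} {g : E → F → E}

/-- Differentiation under the integral sign. -/
theorem isGradientOn_objective (hU : IsCompact U) (hUc : Convex ℝ U) (hS : IsCompact S)
    (hS𝒳 : S ⊆ 𝒳) (h𝒳 : IsOpen 𝒳) (hμS : ∀ᵐ y ∂μ, y ∈ S)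
    (hj : ContinuousOn (Function.uncurry j) (U ×ˢ 𝒳))
    (hg : ContinuousOn (Function.uncurry g) (U ×ˢ 𝒳))
    (hjg : ∀ x ∈ 𝒳, IsGradientOn U (fun u => j u x) (fun u => g u x)) :
    IsGradientOn U (objective μ 𝒳 j) (fun u => ∫ x in 𝒳, g u x ∂μ) := by
  intro u hu
  rw [hasFDerivWithinAt_iff_isLittleO, Asymptotics.isLittleO_iff]
  intro ε hε
  obtain ⟨δ, hδ, hmod⟩ := exists_uniform_modulus hU hS hS𝒳 hg hε
  filter_upwards [self_mem_nhdsWithin, mem_nhdsWithin_of_mem_nhds (Metric.ball_mem_nhds u hδ)]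
    with v hv hvδ
  have hint : ∀ v ∈ U, IntegrableOn (j v) 𝒳 μ := fun v hv =>
    integrable_section hS hS𝒳 h𝒳 hμS hj hv
  have hintg : IntegrableOn (g u) 𝒳 μ := integrable_section hS hS𝒳 h𝒳 hμS hg hu
  have hinner : inner ℝ (∫ x in 𝒳, g u x ∂μ) (v - u) = ∫ x in 𝒳, inner ℝ (g u x) (v - u) ∂μ := by
    rw [real_inner_comm, ← integral_inner hintg]
    simp only [real_inner_comm]
  have hinti : IntegrableOn (fun x => inner ℝ (g u x) (v - u)) 𝒳 μ := hintg.inner_const _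
  have heq : objective μ 𝒳 j v - objective μ 𝒳 j u -
      innerSL ℝ (∫ x in 𝒳, g u x ∂μ) (v - u) =
      ∫ x in 𝒳, (j v x - j u x - inner ℝ (g u x) (v - u)) ∂μ := by
    rw [innerSL_apply_apply, hinner, integral_sub (f := fun x => j v x - j u x)
      ((hint v hv).sub (hint u hu)) hinti, integral_sub (hint v hv) (hint u hu)]
    rfl
  rw [heq]
  have hbound : ∀ᵐ x ∂μ.restrict 𝒳,
      ‖j v x - j u x - inner ℝ (g u x) (v - u)‖ ≤ ε * ‖v - u‖ := by
    refine ae_restrict_of_ae (hμS.mono fun x hx => ?_)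
    -- Mean value inequality on a convex set where `g · x` stays within `ε` of `g u x`, with `δ`
    -- independent of `x ∈ S`.
    have hconv : Convex ℝ (U ∩ Metric.ball u δ) := hUc.inter (convex_ball u δ)
    have := hconv.norm_image_sub_le_of_norm_hasFDerivWithin_le' (f := fun w => j w x)
      (f' := fun w => innerSL ℝ (g w x)) (φ := innerSL ℝ (g u x)) (C := ε)
      (fun w hw => (hjg x (hS𝒳 hx) w hw.1).mono Set.inter_subset_left)
      (fun w hw => by
        rw [← map_sub, innerSL_apply_norm]
        refine (hmod w hw.1 u hu x hx x hx ?_).le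
        rw [sub_self, norm_zero, add_zero, ← dist_eq_norm]
        exact hw.2)
      ⟨hu, Metric.mem_ball_self hδ⟩ ⟨hv, hvδ⟩
    simpa using this
  refine (norm_integral_le_of_norm_le_const hbound).trans (mul_le_of_le_one_right (by positivity) ?_)
  exact measureReal_restrict_apply_univ (μ := μ) 𝒳 ▸ measureReal_le_one

end Objective

/-! ### Nearest indices and measurability of the iterates -/

/-- The smallest index `k ≤ n` that minimizes `a`. -/
def argminIndex (a : ℕ → ℝ) (n : ℕ) : ℕ :=
  sInf {k | k ≤ n ∧ ∀ i ≤ n, a k ≤ a i}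

theorem argminIndex_set_nonempty (a : ℕ → ℝ) (n : ℕ) :
    {k | k ≤ n ∧ ∀ i ≤ n, a k ≤ a i}.Nonempty := by
  obtain ⟨k, hk, h⟩ := (Finset.range (n + 1)).exists_min_image a Finset.nonempty_range_add_one
  exact ⟨k, by simpa [Nat.lt_succ_iff] using hk, fun i hi => h i (by simpa [Nat.lt_succ_iff])⟩

theorem argminIndex_le (a : ℕ → ℝ) (n : ℕ) : argminIndex a n ≤ n :=
  (Nat.sInf_mem (argminIndex_set_nonempty a n)).1

theorem apply_argminIndex_le (a : ℕ → ℝ) {n i : ℕ} (hi : i ≤ n) : a (argminIndex a n) ≤ a i :=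
  (Nat.sInf_mem (argminIndex_set_nonempty a n)).2 i hi

/-- Both nearest-point indices are of this form by definition, so all partition cells are covered.
-/
theorem measurable_argminIndex {Ω : Type*} [MeasurableSpace Ω] {a : ℕ → Ω → ℝ} {n : ℕ}
    (ha : ∀ i ≤ n, Measurable (a i)) : Measurable fun ω => argminIndex (fun i => a i ω) n := by
  classical
  have h := measurable_find (p := fun ω k => k ≤ n ∧ ∀ i ≤ n, a k ω ≤ a i ω)
    (fun ω => argminIndex_set_nonempty (fun i => a i ω) n) fun k => by
      by_cases hk : k ≤ n
      · have : {ω | k ≤ n ∧ ∀ i ≤ n, a k ω ≤ a i ω} = ⋂ i, ⋂ (_ : i ≤ n), {ω | a k ω ≤ a i ω} := by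
          ext; simp [hk]
        rw [this]
        exact MeasurableSet.iInter fun i => MeasurableSet.iInter fun hi =>
          measurableSet_le (ha k hk) (ha i hi)
      · simp [hk]
  convert h using 2 with ω
  have hne := argminIndex_set_nonempty (fun i => a i ω) n
  exact le_antisymm (Nat.sInf_le (Nat.find_spec hne)) (Nat.find_min' hne (Nat.sInf_mem hne))

section Measurability

variable {E F H Ω : Type*} [NormedAddCommGroup E]
  [NormedAddCommGroup F] [MeasurableSpace F] [BorelSpace F] [SecondCountableTopology F]
  [MeasurableSpace E] [BorelSpace E]
  [NormedAddCommGroup H] [MeasurableSpace H] [BorelSpace H]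
  {m : MeasurableSpace Ω} {μ : Measure F} [IsProbabilityMeasure μ] {U : Set E} {𝒳 : Set F}
  {u : ℕ → Ω → E} {X : ℕ → Ω → F} {n : ℕ}

theorem measurable_comp_continuousOn {h : E → F → H}
    (hh : ContinuousOn (Function.uncurry h) (U ×ˢ 𝒳)) {v : Ω → E} {y : Ω → F}
    (hv : Measurable v) (hy : Measurable y) (hvU : ∀ ω, v ω ∈ U) (hy𝒳 : ∀ ω, y ω ∈ 𝒳) :
    Measurable fun ω => h (v ω) (y ω) :=
  hh.domRestrict.measurable.comp
    (g := (U ×ˢ 𝒳).domRestrict (Function.uncurry h)) (f := fun ω => ⟨(v ω, y ω), hvU ω, hy𝒳 ω⟩)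
    ((hv.prodMk hy).subtype_mk)

variable [SecondCountableTopology E]

theorem measurable_weight (rule : WeightRule) (hu : ∀ i ≤ n, Measurable (u i))
    (hX : ∀ i ≤ n, Measurable (X i)) {v : Ω → E} (hv : Measurable v) (k : ℕ) :
    Measurable fun ω => weight rule μ (fun i => u i ω) (fun i => X i ω) n (v ω) k := by
  have hnear : ∀ i ≤ n, Measurable fun ω =>
      nearestIndex (fun i => u i ω) (fun i => X i ω) n (v ω) (X i ω) := fun i hi =>
    measurable_argminIndex (a := fun k ω => ‖v ω - u k ω‖ + ‖X i ω - X k ω‖) fun k hk =>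
      (hv.sub (hu k hk)).norm.add ((hX i hi).sub (hX k hk)).norm
  cases rule with
  | exact =>
    have h : Measurable fun p : Ω × F =>
        nearestIndex (fun i => u i p.1) (fun i => X i p.1) n (v p.1) p.2 :=
      measurable_argminIndex (a := fun k (p : Ω × F) => ‖v p.1 - u k p.1‖ + ‖p.2 - X k p.1‖)
        fun k hk => by
          have := hu k hk
          have := hX k hk
          fun_prop
    exact (measurable_measure_prodMk_left (ν := μ) (h (measurableSet_singleton k))).ennreal_toReal
  | exactHybrid =>
    have h : Measurable fun p : Ω × F => nearestSampleIndex (fun i => X i p.1) n p.2 :=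
      measurable_argminIndex (a := fun k (p : Ω × F) => ‖p.2 - X k p.1‖)
        fun k hk => by
          have := hX k hk
          fun_prop
    refine Finset.measurable_fun_sum _ fun i hi => ?_
    exact Measurable.ite (hnear i (by simpa [Nat.lt_succ_iff] using hi) (measurableSet_singleton k))
      (measurable_measure_prodMk_left (ν := μ) (h (measurableSet_singleton i))).ennreal_toReal
      measurable_const
  | empirical =>
    refine (Finset.measurable_fun_sum _ fun i hi => ?_).div_const _
    exact Measurable.ite (hnear i (by simpa [Nat.lt_succ_iff] using hi) (measurableSet_singleton k))
      measurable_const measurable_const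

theorem measurable_sum_weight [NormedSpace ℝ H] [SecondCountableTopology H] (rule : WeightRule)
    {h : E → F → H} (hh : ContinuousOn (Function.uncurry h) (U ×ˢ 𝒳))
    (hu : ∀ i ≤ n, Measurable (u i)) (hX : ∀ i ≤ n, Measurable (X i)) (huU : ∀ i ω, u i ω ∈ U)
    (hX𝒳 : ∀ i ω, X i ω ∈ 𝒳) {v : Ω → E} (hv : Measurable v) :
    Measurable fun ω => ∑ k ∈ Finset.range (n + 1),
      weight rule μ (fun i => u i ω) (fun i => X i ω) n (v ω) k • h (u k ω) (X k ω) := by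
  refine Finset.measurable_fun_sum _ fun k hk => ?_
  have hk' : k ≤ n := by simpa [Nat.lt_succ_iff] using hk
  exact (measurable_weight rule hu hX hv k).smul
    (measurable_comp_continuousOn hh (hu k hk') (hX k hk') (huU k) (hX𝒳 k))

/-- The loop is a finite decision tree whose trial steps do not depend on `ω`; only the branch taken
does. -/
theorem measurable_backtrack {A W : Ω → ℝ → Prop} (hA : ∀ t, MeasurableSet {ω | A ω t})
    (hW : ∀ t, MeasurableSet {ω | W ω t}) (T : ℕ) : ∀ (a : ℝ) (b ηA : Option ℝ) (t : ℝ),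
    Measurable fun ω => backtrack (A ω) (W ω) T a b ηA t := by
  induction T with
  | zero => intro a b ηA t; simpa only [backtrack] using measurable_const
  | succ T ih =>
    intro a b ηA t
    unfold backtrack
    exact Measurable.ite (hA t).compl (ih _ _ _ _)
      (Measurable.ite (hW t) (ih _ _ _ _) measurable_const)

theorem measurable_next_iterate [InnerProductSpace ℝ E] (rule : WeightRule) (ls : LineSearch) (hU : IsCompact U)
    (hUc : Convex ℝ U) (hne : U.Nonempty)
    {j : E → F → ℝ} {g : E → F → E}
    (hj : ContinuousOn (Function.uncurry j) (U ×ˢ 𝒳))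
    (hg : ContinuousOn (Function.uncurry g) (U ×ˢ 𝒳))
    (hu : ∀ i ≤ n, Measurable (u i)) (hX : ∀ i ≤ n, Measurable (X i)) (huU : ∀ i ω, u i ω ∈ U)
    (hX𝒳 : ∀ i ω, X i ω ∈ 𝒳) :
    Measurable fun ω => proj U (u n ω -
      stepSize rule μ U j g ls (fun i => u i ω) (fun i => X i ω) n •
        gradApprox rule μ g (fun i => u i ω) (fun i => X i ω) n (u n ω)) := by
  have hgrad : ∀ v : Ω → E, Measurable v → Measurable fun ω =>
      gradApprox rule μ g (fun i => u i ω) (fun i => X i ω) n (v ω) := fun v hv =>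
    measurable_sum_weight rule hg hu hX huU hX𝒳 hv
  have hval : ∀ k ≤ n, ∀ v : Ω → E, Measurable v → Measurable fun ω =>
      valueApprox rule μ j (fun i => u i ω) (fun i => X i ω) k (v ω) := fun k hk v hv =>
    measurable_sum_weight rule hj (fun i hi => hu i (hi.trans hk))
      (fun i hi => hX i (hi.trans hk)) huU hX𝒳 hv
  have hun := hu n le_rfl
  have hG := hgrad _ hun
  have htrial : ∀ t, Measurable fun ω =>
      trial rule μ U g (fun i => u i ω) (fun i => X i ω) n t := fun t =>
    (continuous_proj hU hne hUc).measurable.comp (hun.sub (hG.const_smul t))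
  have hstep : Measurable fun ω =>
      stepSize rule μ U j g ls (fun i => u i ω) (fun i => X i ω) n := by
    refine measurable_backtrack (fun t => ?_) (fun t => ?_) _ _ _ _ _
    · refine measurableSet_le (hval n le_rfl _ (htrial t)) ?_
      refine Measurable.sub ?_ ((hG.inner (hun.sub (htrial t))).const_mul _)
      have := Finset.measurable_sup' (Finset.nonempty_range_add_one (n := min ls.K n))
        (f := fun k ω => valueApprox rule μ j (fun i => u i ω) (fun i => X i ω) (n - k)
          (u (n - k) ω))
        (fun k _ => hval (n - k) (Nat.sub_le _ _) _ (hu (n - k) (Nat.sub_le _ _)))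
      convert this using 1
      ext ω
      simp [Finset.sup'_apply]
    · refine (measurableSet_eq_fun (htrial t) (hun.sub (hG.const_smul t))).inter
        (MeasurableSet.compl ?_)
      exact measurableSet_le ((hG.inner (𝕜 := ℝ) ((htrial t).sub hun)).const_mul _)
        ((hgrad _ (htrial t)).inner ((htrial t).sub hun))
  exact (continuous_proj hU hne hUc).measurable.comp (hun.sub (hstep.smul hG))

end Measurability

section Iterates

variable {E F Ω : Type*} [NormedAddCommGroup E] [InnerProductSpace ℝ E]
  [NormedAddCommGroup F] [MeasurableSpace F] {μ : Measure F} {U : Set E} {𝒳 : Set F}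
  {rule : WeightRule} {ls : LineSearch} {j : E → F → ℝ} {g : E → F → E} {u₀ : E}

theorem IsBacktrackingCSG.mem (hU : IsCompact U) (hUc : Convex ℝ U) (hu₀ : u₀ ∈ U) {x : ℕ → F}
    {u : ℕ → E} (h : IsBacktrackingCSG rule μ U j g ls u₀ x u) : ∀ n, u n ∈ U
  | 0 => h.1 ▸ hu₀
  | n + 1 => h.2 n ▸ proj_mem hU ⟨u₀, hu₀⟩ hUc _

/-- The iterates depend measurably on the previous samples. -/
theorem measurable_iterate [BorelSpace F] [SecondCountableTopology F] [IsProbabilityMeasure μ]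
    [MeasurableSpace E] [BorelSpace E] [SecondCountableTopology E]
    (hU : IsCompact U) (hUc : Convex ℝ U) (hu₀ : u₀ ∈ U)
    (hj : ContinuousOn (Function.uncurry j) (U ×ˢ 𝒳))
    (hg : ContinuousOn (Function.uncurry g) (U ×ˢ 𝒳))
    {X : ℕ → Ω → F} {u : ℕ → Ω → E} (hX𝒳 : ∀ i ω, X i ω ∈ 𝒳)
    (hu : ∀ ω, IsBacktrackingCSG rule μ U j g ls u₀ (fun n => X n ω) (fun n => u n ω))
    (n : ℕ) : ∀ m : MeasurableSpace Ω, (∀ i < n, Measurable[m] (X i)) → Measurable[m] (u n) := by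
  induction n using Nat.strong_induction_on with
  | _ n ih =>
    intro m hX
    cases n with
    | zero =>
      have : u 0 = fun _ => u₀ := funext fun ω => (hu ω).1
      rw [this]
      exact measurable_const
    | succ n =>
      have : u (n + 1) = _ := funext fun ω => (hu ω).2 n
      rw [this]
      exact measurable_next_iterate rule ls hU hUc ⟨u₀, hu₀⟩ hj hg
        (fun i hi => ih i (by omega) m fun k hk => hX k (by omega))
        (fun i hi => hX i (by omega)) (fun i ω => (hu ω).mem hU hUc hu₀ i) hX𝒳

end Iterates

/-! ### Density of the pairs of iterates and samples -/

/-- Uniform version of the density of the iterates paired with the samples. -/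
theorem exists_uniform_density {E F : Type*} [NormedAddCommGroup E]
    [NormedAddCommGroup F] {U : Set E}
    {S : Set F} (hU : IsCompact U) (hS : IsCompact S) {u : ℕ → E} {x : ℕ → F}
    (huU : ∀ n, u n ∈ U)
    (hdense : ∀ p, MapClusterPt p atTop u → ∀ y ∈ S, MapClusterPt (p, y) atTop fun n => (u n, x n))
    {ε : ℝ} (hε : 0 < ε) :
    ∃ N, ∀ m ≥ N, ∀ y ∈ S, ∃ k < N, ‖u m - u k‖ + ‖y - x k‖ < ε := by
  by_contra! hcon
  -- Along a limit `(p, q)` of the bad pairs `(u (φ N), y N)`, some fixed `(u k, x k)` lies within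
  -- `ε / 2` of `(p, q)`, contradicting badness once `N > k`.
  choose φ hφ y hyS hy using hcon
  have hφt : Tendsto φ atTop atTop := tendsto_atTop_mono hφ tendsto_id
  obtain ⟨⟨p, q⟩, ⟨-, hq⟩, ψ, hψ, hlim⟩ := (hU.prod hS).tendsto_subseq
    (x := fun N => (u (φ N), y N)) (fun N => ⟨huU _, hyS N⟩)
  have hp : MapClusterPt p atTop u :=
    MapClusterPt.of_comp (hφt.comp hψ.tendsto_atTop)
      ((continuous_fst.tendsto _).comp hlim).mapClusterPt
  have hev : ∀ {v : E} {z : F}, ∀ᶠ r : E × F in 𝓝 (v, z), ‖v - r.1‖ + ‖z - r.2‖ < ε / 2 := by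
    intro v z
    have : Tendsto (fun r : E × F => ‖v - r.1‖ + ‖z - r.2‖) (𝓝 (v, z)) (𝓝 0) := by
      have hcont : Continuous fun r : E × F => ‖v - r.1‖ + ‖z - r.2‖ := by fun_prop
      simpa using hcont.tendsto (v, z)
    exact this.eventually (gt_mem_nhds (half_pos hε))
  obtain ⟨k, hk⟩ := ((hdense p hp q hq).frequently hev).exists
  obtain ⟨i, hi1, hi2⟩ := ((hlim.eventually hev).and
    (hψ.tendsto_atTop.eventually (eventually_gt_atTop k))).exists
  have h1 := hy (ψ i) k hi2
  simp only [Function.comp_apply] at hi1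
  have h2 := norm_sub_le_norm_sub_add_norm_sub (u (φ (ψ i))) p (u k)
  have h3 := norm_sub_le_norm_sub_add_norm_sub (y (ψ i)) q (x k)
  rw [norm_sub_rev p, norm_sub_rev q] at hi1
  linarith

section Density

variable {E F Ω : Type*} [mΩ : MeasurableSpace Ω] {P : Measure Ω}
  [mF : MeasurableSpace F] {μ : Measure F} {X : ℕ → Ω → F}

/-- The σ-algebras generated by the samples with smaller index. -/
def pastFiltration (hX : ∀ n, Measurable (X n)) : Filtration ℕ mΩ where
  seq n := ⨆ i ∈ Set.Iio n, mF.comap (X i)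
  mono' _ _ hmn := biSup_mono fun _ hi => lt_of_lt_of_le hi hmn
  le' _ := iSup₂_le fun i _ => (hX i).comap_le

theorem measurable_pastFiltration (hX : ∀ n, Measurable (X n)) {i n : ℕ} (hi : i < n) :
    Measurable[pastFiltration hX n] (X i) := by
  rw [measurable_iff_comap_le]
  exact le_iSup₂ (f := fun i (_ : i ∈ Set.Iio n) => mF.comap (X i)) i hi

theorem indep_pastFiltration (hX : ∀ n, Measurable (X n)) (hind : iIndepFun X P) (n : ℕ) :
    Indep (mF.comap (X n)) (pastFiltration hX n) P := by
  have h := indep_iSup_of_disjoint (fun i => (hX i).comap_le) hind.iIndep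
    (S := {n}) (T := Set.Iio n) (by simp)
  rwa [iSup_singleton] at h

variable [IsProbabilityMeasure P]

/-- If a previsible sequence visits `B` infinitely often and `C` has positive probability, then
infinitely many of the visits happen together with a sample in `C`. -/
theorem ae_frequently_and_mem [MeasurableSpace E] {u : ℕ → Ω → E} (hX : ∀ n, Measurable (X n))
    (hind : iIndepFun X P) (hlaw : ∀ n, P.map (X n) = μ)
    (hu : ∀ n, Measurable[pastFiltration hX n] (u n)) {B : Set E} (hB : MeasurableSet B)
    {C : Set F} (hC : MeasurableSet C) (hμC : 0 < μ C) :
    ∀ᵐ ω ∂P, (∃ᶠ n in atTop, u n ω ∈ B) → ∃ᶠ n in atTop, u n ω ∈ B ∧ X n ω ∈ C := by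
  have : IsProbabilityMeasure μ := hlaw 0 ▸ Measure.isProbabilityMeasure_map (hX 0).aemeasurable
  set 𝓖 := pastFiltration hX with h𝓖
  have hBm : ∀ n, MeasurableSet[𝓖 n] (u n ⁻¹' B) := fun n => hu n hB
  have hCm : ∀ n, MeasurableSet (X n ⁻¹' C) := fun n => hX n hC
  -- The index is shifted because `u n` is known at time `n` but `X n` only at time `n + 1`.
  set s : ℕ → Set Ω := fun n => if n = 0 then ∅ else u (n - 1) ⁻¹' B ∩ X (n - 1) ⁻¹' C with hs
  have hss : ∀ n, s (n + 1) = u n ⁻¹' B ∩ X n ⁻¹' C := fun n => by simp [hs]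
  have hsm : ∀ n, MeasurableSet[𝓖 n] (s n) := by
    intro n
    cases n with
    | zero => simp [hs]
    | succ n =>
      rw [hss]
      exact (𝓖.mono n.le_succ _ (hBm n)).inter (measurable_pastFiltration hX n.lt_succ_self hC)
  have hcond : ∀ n, P[(s (n + 1)).indicator (1 : Ω → ℝ) | 𝓖 n] =ᵐ[P]
      (u n ⁻¹' B).indicator (fun _ => μ.real C) := by
    intro n
    have h1 : (s (n + 1)).indicator (1 : Ω → ℝ) =
        (u n ⁻¹' B).indicator ((X n ⁻¹' C).indicator (1 : Ω → ℝ)) := by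
      rw [hss, Set.indicator_indicator]
    have h2 : P[(X n ⁻¹' C).indicator (1 : Ω → ℝ) | 𝓖 n] =ᵐ[P] fun _ => μ.real C := by
      have := condExp_indep_eq (μ := P) (m₁ := mF.comap (X n)) (m₂ := 𝓖 n) (hX n).comap_le
        (𝓖.le n) (f := (X n ⁻¹' C).indicator (1 : Ω → ℝ))
        (StronglyMeasurable.indicator stronglyMeasurable_one ⟨C, hC, rfl⟩)
        (indep_pastFiltration hX hind n)
      rw [integral_indicator_one (hCm n)] at this
      rwa [← hlaw n, map_measureReal_apply (hX n) hC]
    have h3 := condExp_indicator (m := 𝓖 n) (μ := P)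
      ((integrable_const (1 : ℝ)).indicator (hCm n)) (hBm n)
    rw [h1]
    refine h3.trans ?_
    filter_upwards [h2] with ω hω
    by_cases hωB : ω ∈ u n ⁻¹' B
    · rw [Set.indicator_of_mem hωB, Set.indicator_of_mem hωB]
      exact hω
    · rw [Set.indicator_of_notMem hωB, Set.indicator_of_notMem hωB]
  -- By Lévy's lemma the events occur infinitely often iff the conditional probabilities, `μ.real C`
  -- at each visit to `B`, have a divergent sum.
  filter_upwards [ae_mem_limsup_atTop_iff (ℱ := 𝓖) P hsm, ae_all_iff.2 hcond] with ω h1 h2 hfr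
  have hpos : 0 < μ.real C := ENNReal.toReal_pos hμC.ne' (measure_ne_top μ C)
  have h3 : ω ∈ limsup (fun n => u n ⁻¹' B) atTop := mem_limsup_iff_frequently_mem.2 hfr
  rw [Set.limsup_eq_tendsto_sum_indicator_atTop hpos] at h3
  have h4 : ω ∈ limsup s atTop := by
    refine h1.2 ?_
    simp only [h2]
    exact h3
  have h5 := frequently_atTop.1 (mem_limsup_iff_frequently_mem.1 h4)
  refine frequently_atTop.2 fun N => ?_
  obtain ⟨n, hn, hmem⟩ := h5 (N + 1)
  obtain ⟨n, rfl⟩ : ∃ k, n = k + 1 := ⟨n - 1, by omega⟩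
  rw [hss] at hmem
  exact ⟨n, by omega, hmem⟩

/-- Every pair of a cluster point of the iterates and a point of the support is a cluster point of
the iterates paired with the samples. -/
theorem ae_mapClusterPt_prod [TopologicalSpace E] [SecondCountableTopology E] [MeasurableSpace E]
    [BorelSpace E] [TopologicalSpace F] [SecondCountableTopology F] [BorelSpace F]
    {u : ℕ → Ω → E} (hX : ∀ n, Measurable (X n))
    (hind : iIndepFun X P) (hlaw : ∀ n, P.map (X n) = μ)
    (hu : ∀ n, Measurable[pastFiltration hX n] (u n)) :
    ∀ᵐ ω ∂P, ∀ p, MapClusterPt p atTop (fun n => u n ω) → ∀ y ∈ μ.support,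
      MapClusterPt (p, y) atTop (fun n => (u n ω, X n ω)) := by
  -- Countable bases leave a single exceptional null set for all `p` and `y`.
  have h : ∀ᵐ ω ∂P, ∀ B ∈ TopologicalSpace.countableBasis E,
      ∀ C ∈ TopologicalSpace.countableBasis F, 0 < μ C →
        (∃ᶠ n in atTop, u n ω ∈ B) → ∃ᶠ n in atTop, u n ω ∈ B ∧ X n ω ∈ C := by
    refine (ae_ball_iff (TopologicalSpace.countable_countableBasis E)).2 fun B hB => ?_
    refine (ae_ball_iff (TopologicalSpace.countable_countableBasis F)).2 fun C hC => ?_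
    by_cases hμC : 0 < μ C
    · filter_upwards [ae_frequently_and_mem hX hind hlaw hu
        (TopologicalSpace.isOpen_of_mem_countableBasis hB).measurableSet
        (TopologicalSpace.isOpen_of_mem_countableBasis hC).measurableSet hμC] with ω hω _ using hω
    · exact Eventually.of_forall fun ω h => absurd h hμC
  filter_upwards [h] with ω hω p hp y hy
  have hbE := TopologicalSpace.isBasis_countableBasis E
  have hbF := TopologicalSpace.isBasis_countableBasis F
  refine ((hbE.nhds_hasBasis (a := p)).prod_nhds
    (hbF.nhds_hasBasis (a := y))).mapClusterPt_iff_frequently.2 ?_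
  rintro ⟨B, C⟩ ⟨⟨hB, hpB⟩, hC, hyC⟩
  exact hω B hB C hC ((Measure.mem_support_iff_forall y).1 hy C (hbF.mem_nhds hC hyC))
    (hp.frequently (hbE.mem_nhds hB hpB))

end Density

/-! ### Consistency of the weighted sums -/

section Approximation

variable {E F H Ω : Type*} [NormedAddCommGroup E] [NormedAddCommGroup F] [NormedAddCommGroup H]
  [NormedSpace ℝ H]

theorem norm_sum_div_sub_le {a b : ℕ → H} {ε : ℝ} (n : ℕ) (hε : ∀ i, ‖a i - b i‖ ≤ ε) :
    ‖((n : ℝ) + 1)⁻¹ • ∑ i ∈ Finset.range (n + 1), a i -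
      ((n : ℝ) + 1)⁻¹ • ∑ i ∈ Finset.range (n + 1), b i‖ ≤ ε := by
  have hn : (0 : ℝ) < n + 1 := by positivity
  rw [← smul_sub, ← Finset.sum_sub_distrib, norm_smul, norm_inv, Real.norm_of_nonneg hn.le,
    inv_mul_le_iff₀ hn]
  refine (norm_sum_le_of_le _ fun i _ => hε i).trans ?_
  simp

/-- Regroups a sum over cells into a sum over samples, with `w` the hybrid masses or `1`. -/
theorem sum_sum_ite_smul {n : ℕ} (κ : ℕ → ℕ) (hκ : ∀ i, κ i ≤ n) (w : ℕ → ℝ) (c : ℕ → H) :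
    ∑ k ∈ Finset.range (n + 1),
      (∑ i ∈ Finset.range (n + 1), if κ i = k then w i else 0) • c k =
    ∑ i ∈ Finset.range (n + 1), w i • c (κ i) := by
  simp_rw [Finset.sum_smul]
  rw [Finset.sum_comm]
  refine Finset.sum_congr rfl fun i _ => ?_
  simp [ite_smul, hκ i]

theorem integral_comp_index [CompleteSpace H] {F : Type*} [MeasurableSpace F] {μ : Measure F}
    [IsProbabilityMeasure μ] {κ : F → ℕ} (hκ : Measurable κ) {n : ℕ}
    (hκn : ∀ y, κ y ≤ n) (c : ℕ → H) :
    ∫ y, c (κ y) ∂μ = ∑ k ∈ Finset.range (n + 1), μ.real {y | κ y = k} • c k := by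
  have hm : ∀ k, MeasurableSet {y | κ y = k} := fun k => hκ (measurableSet_singleton k)
  have h1 : ∀ y, c (κ y) =
      ∑ k ∈ Finset.range (n + 1), {y | κ y = k}.indicator (fun _ => c k) y := by
    intro y
    simp [Set.indicator_apply, hκn y]
  simp_rw [h1]
  rw [integral_finsetSum _ fun k _ => (integrable_const _).indicator (hm k)]
  exact Finset.sum_congr rfl fun k _ => integral_indicator_const _ (hm k)

variable [MeasurableSpace F] {μ : Measure F} [IsProbabilityMeasure μ] {U : Set E} {𝒳 S : Set F}
  {h : E → F → H}

variable [BorelSpace F] [SecondCountableTopology F]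

/-- Error estimate for the weighted sums: comparison with the integral, or with the empirical mean
in the case of empirical weights. -/
theorem norm_sum_weight_sub_le [CompleteSpace H] (hS : IsCompact S) (hS𝒳 : S ⊆ 𝒳) (h𝒳 : IsOpen 𝒳)
    (hμS : ∀ᵐ y ∂μ, y ∈ S) (hh : ContinuousOn (Function.uncurry h) (U ×ˢ 𝒳)) (rule : WeightRule)
    {u : ℕ → E} {x : ℕ → F} (hu : ∀ i, u i ∈ U) (hx : ∀ i, x i ∈ S) {n : ℕ} {v : E} (hv : v ∈ U)
    {ε δ : ℝ}
    (hmod : ∀ v ∈ U, ∀ v' ∈ U, ∀ y ∈ S, ∀ y' ∈ S, ‖v - v'‖ + ‖y - y'‖ < δ → ‖h v y - h v' y'‖ < ε)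
    (hdens : ∀ y ∈ S, ∃ k ≤ n, ‖v - u k‖ + ‖y - x k‖ < δ / 2) :
    ‖∑ k ∈ Finset.range (n + 1), weight rule μ u x n v k • h (u k) (x k) - ∫ y in 𝒳, h v y ∂μ‖ ≤
      ε + ‖((n : ℝ) + 1)⁻¹ • ∑ i ∈ Finset.range (n + 1), h v (x i) - ∫ y in 𝒳, h v y ∂μ‖ := by
  have hrestr : μ.restrict 𝒳 = μ := Measure.restrict_eq_self_of_ae_mem (hμS.mono fun _ hy => hS𝒳 hy)
  have hint : Integrable (h v) μ := by
    have := integrable_section hS hS𝒳 h𝒳 hμS hh hv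
    rwa [IntegrableOn, hrestr] at this
  rw [hrestr]
  have hnear : ∀ y, nearestIndex u x n v y ≤ n := fun y => argminIndex_le _ _
  have hclose : ∀ y ∈ S, ‖v - u (nearestIndex u x n v y)‖ + ‖y - x (nearestIndex u x n v y)‖
      < δ / 2 := fun y hy => by
    obtain ⟨k, hk, hlt⟩ := hdens y hy
    exact (apply_argminIndex_le (fun k => ‖v - u k‖ + ‖y - x k‖) hk).trans_lt hlt
  have hδ : 0 < δ := by
    have := hclose _ (hx 0)
    linarith [norm_nonneg (v - u (nearestIndex u x n v (x 0))),
      norm_nonneg (x 0 - x (nearestIndex u x n v (x 0)))]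
  have hmean : ∀ f : F → H, Integrable f μ → (∀ y ∈ S, ‖f y - h v y‖ ≤ ε) →
      ‖∫ y, f y ∂μ - ∫ y, h v y ∂μ‖ ≤ ε := fun f hf hfε => by
    rw [← integral_sub hf hint]
    simpa using norm_integral_le_of_norm_le_const (hμS.mono hfε)
  have hbdd : ∀ {κ : F → ℕ}, Measurable κ → (∀ y, κ y ≤ n) → ∀ c : ℕ → H,
      Integrable (fun y => c (κ y)) μ := by
    intro κ hκ hκn c
    refine Integrable.of_bound (C := ∑ k ∈ Finset.range (n + 1), ‖c k‖)
      ((StronglyMeasurable.of_discrete (f := c)).comp_measurable hκ).aestronglyMeasurable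
      (Eventually.of_forall fun y => ?_)
    exact Finset.single_le_sum (f := fun k => ‖c k‖) (fun _ _ => norm_nonneg _)
      (by simpa [Nat.lt_succ_iff] using hκn y)
  cases rule with
  | exact =>
    have hκ : Measurable (nearestIndex u x n v) :=
      measurable_argminIndex (a := fun k y => ‖v - u k‖ + ‖y - x k‖) fun k _ => by fun_prop
    have hsum := integral_comp_index (μ := μ) hκ hnear fun k => h (u k) (x k)
    simp only [weight]
    rw [← hsum]
    refine le_add_of_le_of_nonneg (hmean _ (hbdd hκ hnear fun k => h (u k) (x k)) fun y hy => ?_)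
      (norm_nonneg _)
    refine (hmod _ (hu _) _ hv _ (hx _) _ hy ?_).le
    have := hclose y hy
    rw [norm_sub_rev (u _), norm_sub_rev (x _)]
    linarith
  | exactHybrid =>
    have hι : Measurable (nearestSampleIndex x n) :=
      measurable_argminIndex (a := fun k y => ‖y - x k‖) fun k _ => by fun_prop
    have hιn : ∀ y, nearestSampleIndex x n y ≤ n := fun y => argminIndex_le _ _
    have hsum := integral_comp_index (μ := μ) hι hιn
      fun i => h (u (nearestIndex u x n v (x i))) (x (nearestIndex u x n v (x i)))
    simp only [weight]
    rw [sum_sum_ite_smul (fun i => nearestIndex u x n v (x i)) (fun i => hnear (x i))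
      (fun i => μ.real {y | nearestSampleIndex x n y = i}) (fun k => h (u k) (x k)), ← hsum]
    refine le_add_of_le_of_nonneg (hmean _ (hbdd hι hιn fun i =>
      h (u (nearestIndex u x n v (x i))) (x (nearestIndex u x n v (x i)))) fun y hy => ?_)
      (norm_nonneg _)
    refine (hmod _ (hu _) _ hv _ (hx _) _ hy ?_).le
    -- Two moves, from `y` to its nearest sample and from there to the nearest pair, cost less than
    -- `δ / 2` each.
    obtain ⟨k, hk, hlt⟩ := hdens y hy
    have h1 := apply_argminIndex_le (fun k => ‖y - x k‖) hk
    change ‖y - x (nearestSampleIndex x n y)‖ ≤ ‖y - x k‖ at h1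
    have h2 := hclose _ (hx (nearestSampleIndex x n y))
    have h3 := norm_sub_le_norm_sub_add_norm_sub y (x (nearestSampleIndex x n y))
      (x (nearestIndex u x n v (x (nearestSampleIndex x n y))))
    rw [norm_sub_rev, norm_sub_rev (x _)]
    linarith [norm_nonneg (v - u k)]
  | empirical =>
    refine (norm_sub_le_norm_sub_add_norm_sub _ _ _).trans (add_le_add_left ?_ _)
    have h1 : ∑ k ∈ Finset.range (n + 1), weight .empirical μ u x n v k • h (u k) (x k) =
        ((n : ℝ) + 1)⁻¹ • ∑ i ∈ Finset.range (n + 1),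
          h (u (nearestIndex u x n v (x i))) (x (nearestIndex u x n v (x i))) := by
      have := sum_sum_ite_smul (fun i => nearestIndex u x n v (x i)) (fun i => hnear (x i))
        (fun _ => 1) (fun k => h (u k) (x k))
      simp only [one_smul] at this
      rw [← this, Finset.smul_sum]
      refine Finset.sum_congr rfl fun k _ => ?_
      rw [weight, div_eq_inv_mul, mul_smul]
    rw [h1]
    refine norm_sum_div_sub_le n fun i => (hmod _ (hu _) _ hv _ (hx _) _ (hx _) ?_).le
    rw [norm_sub_rev, norm_sub_rev (x _)]
    linarith [hclose _ (hx i)]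

variable [MeasurableSpace Ω] {P : Measure Ω} {X : ℕ → Ω → F}

theorem ae_tendsto_empirical_mean [CompleteSpace H] (hS : IsCompact S) (hS𝒳 : S ⊆ 𝒳)
    (h𝒳 : IsOpen 𝒳) (hμS : ∀ᵐ y ∂μ, y ∈ S) (hh : ContinuousOn (Function.uncurry h) (U ×ˢ 𝒳))
    (hX : ∀ n, Measurable (X n)) (hX𝒳 : ∀ n ω, X n ω ∈ 𝒳) (hind : iIndepFun X P)
    (hlaw : ∀ n, P.map (X n) = μ) {v : E} (hv : v ∈ U) :
    ∀ᵐ ω ∂P, Tendsto (fun n : ℕ => ((n : ℝ) + 1)⁻¹ • ∑ i ∈ Finset.range (n + 1), h v (X i ω)) atTop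
      (𝓝 (∫ y in 𝒳, h v y ∂μ)) := by
  borelize H
  have hc : ContinuousOn (h v) 𝒳 :=
    hh.comp (f := fun y => (v, y)) (by fun_prop) fun y hy => ⟨hv, hy⟩
  -- Extension by zero gives a globally measurable function, unchanged at the samples, to which the
  -- strong law applies.
  have hφ : Measurable (𝒳.indicator (h v)) := by
    classical
    rw [← Set.piecewise_eq_indicator]
    exact hc.measurable_piecewise continuousOn_const h𝒳.measurableSet
  have hφi : Integrable (𝒳.indicator (h v)) μ :=
    (integrable_indicator_iff h𝒳.measurableSet).2 (integrable_section hS hS𝒳 h𝒳 hμS hh hv)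
  have hlaw0 := hlaw 0
  have hint : Integrable (𝒳.indicator (h v) ∘ X 0) P := by
    rw [← hlaw0] at hφi
    exact hφi.comp_measurable (hX 0)
  have hE : P[𝒳.indicator (h v) ∘ X 0] = ∫ y in 𝒳, h v y ∂μ := by
    rw [← integral_indicator h𝒳.measurableSet, ← hlaw0,
      integral_map (hX 0).aemeasurable (hlaw0 ▸ hφi.aestronglyMeasurable)]
    rfl
  have hslln := strong_law_ae (μ := P) (fun i => 𝒳.indicator (h v) ∘ X i) hint
    (fun i k hik => (hind.indepFun hik).comp hφ hφ)
    (fun i => IdentDistrib.comp ⟨(hX i).aemeasurable, (hX 0).aemeasurable,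
      (hlaw i).trans hlaw0.symm⟩ hφ)
  filter_upwards [hslln] with ω hω
  rw [hE] at hω
  refine (hω.comp (tendsto_add_atTop_nat 1)).congr fun n => ?_
  simp [Set.indicator_of_mem (hX𝒳 _ ω)]

/-- Uniform law of large numbers. -/
theorem ae_eventually_empirical_mean_sub_le [CompleteSpace H] (hU : IsCompact U) (hS : IsCompact S)
    (hS𝒳 : S ⊆ 𝒳)
    (h𝒳 : IsOpen 𝒳) (hμS : ∀ᵐ y ∂μ, y ∈ S) (hh : ContinuousOn (Function.uncurry h) (U ×ˢ 𝒳))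
    (hX : ∀ n, Measurable (X n)) (hX𝒳 : ∀ n ω, X n ω ∈ 𝒳) (hind : iIndepFun X P)
    (hlaw : ∀ n, P.map (X n) = μ) (hXS : ∀ᵐ ω ∂P, ∀ n, X n ω ∈ S) {ε : ℝ} (hε : 0 < ε) :
    ∀ᵐ ω ∂P, ∀ᶠ n : ℕ in atTop, ∀ v ∈ U,
      ‖((n : ℝ) + 1)⁻¹ • ∑ i ∈ Finset.range (n + 1), h v (X i ω) - ∫ y in 𝒳, h v y ∂μ‖ ≤ ε := by
  obtain ⟨δ, hδ, hmod⟩ := exists_uniform_modulus hU hS hS𝒳 hh (show 0 < ε / 3 by positivity)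
  -- The pointwise law on a finite net, plus equicontinuity of both the means and the integral,
  -- gives uniformity.
  obtain ⟨t, htU, htf, htc⟩ := hU.finite_cover_balls hδ
  have hnet : ∀ᵐ ω ∂P, ∀ v ∈ t, Tendsto (fun n : ℕ => ((n : ℝ) + 1)⁻¹ •
      ∑ i ∈ Finset.range (n + 1), h v (X i ω)) atTop (𝓝 (∫ y in 𝒳, h v y ∂μ)) :=
    (ae_ball_iff htf.countable).2 fun v hv =>
      ae_tendsto_empirical_mean hS hS𝒳 h𝒳 hμS hh hX hX𝒳 hind hlaw (htU hv)
  filter_upwards [hnet, hXS] with ω hω hωS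
  have hev : ∀ᶠ n : ℕ in atTop, ∀ v ∈ t, ‖((n : ℝ) + 1)⁻¹ •
      ∑ i ∈ Finset.range (n + 1), h v (X i ω) - ∫ y in 𝒳, h v y ∂μ‖ < ε / 3 := by
    refine (eventually_all_finite htf).2 fun v hv => ?_
    have := Metric.tendsto_nhds.1 (hω v hv) (ε / 3) (by positivity)
    simpa only [dist_eq_norm] using this
  filter_upwards [hev] with n hn v hv
  obtain ⟨w, hwt, hvw⟩ := Set.mem_iUnion₂.1 (htc hv)
  rw [Metric.mem_ball, dist_eq_norm] at hvw
  have hclose : ∀ y ∈ S, ‖h v y - h w y‖ ≤ ε / 3 := fun y hy =>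
    (hmod v hv w (htU hwt) y hy y hy (by simpa using hvw)).le
  have h1 := norm_sum_div_sub_le (a := fun i => h v (X i ω)) (b := fun i => h w (X i ω)) n
    fun i => hclose _ (hωS i)
  have h2 : ‖∫ y in 𝒳, h w y ∂μ - ∫ y in 𝒳, h v y ∂μ‖ ≤ ε / 3 := by
    rw [← integral_sub (integrable_section hS hS𝒳 h𝒳 hμS hh (htU hwt))
      (integrable_section hS hS𝒳 h𝒳 hμS hh hv)]
    refine (norm_integral_le_of_norm_le_const (C := ε / 3) (ae_restrict_of_ae (hμS.mono
      fun y hy => norm_sub_rev (h v y) (h w y) ▸ hclose y hy))).trans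
      (mul_le_of_le_one_right (by positivity) ?_)
    exact measureReal_restrict_apply_univ (μ := μ) 𝒳 ▸ measureReal_le_one
  have h3 := norm_sub_le_norm_sub_add_norm_sub
    (((n : ℝ) + 1)⁻¹ • ∑ i ∈ Finset.range (n + 1), h v (X i ω))
    (((n : ℝ) + 1)⁻¹ • ∑ i ∈ Finset.range (n + 1), h w (X i ω)) (∫ y in 𝒳, h v y ∂μ)
  have h4 := norm_sub_le_norm_sub_add_norm_sub
    (((n : ℝ) + 1)⁻¹ • ∑ i ∈ Finset.range (n + 1), h w (X i ω))
    (∫ y in 𝒳, h w y ∂μ) (∫ y in 𝒳, h v y ∂μ)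
  linarith [hn w hwt]

/-- Consistency of the weighted sums along the iterates. -/
theorem ae_eventually_sum_weight_sub_le [CompleteSpace H] (hU : IsCompact U) (hS : IsCompact S)
    (hS𝒳 : S ⊆ 𝒳)
    (h𝒳 : IsOpen 𝒳) (hμS : ∀ᵐ y ∂μ, y ∈ S) (hh : ContinuousOn (Function.uncurry h) (U ×ˢ 𝒳))
    (hX : ∀ n, Measurable (X n)) (hX𝒳 : ∀ n ω, X n ω ∈ 𝒳) (hind : iIndepFun X P)
    (hlaw : ∀ n, P.map (X n) = μ) (hXS : ∀ᵐ ω ∂P, ∀ n, X n ω ∈ S) (rule : WeightRule)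
    {u : ℕ → Ω → E} (huU : ∀ n ω, u n ω ∈ U)
    (hdense : ∀ᵐ ω ∂P, ∀ p, MapClusterPt p atTop (fun n => u n ω) → ∀ y ∈ S,
      MapClusterPt (p, y) atTop fun n => (u n ω, X n ω)) :
    ∀ᵐ ω ∂P, ∀ ε > 0, ∀ᶠ n in atTop, ∀ m ≥ n,
      ‖∑ k ∈ Finset.range (n + 1), weight rule μ (fun i => u i ω) (fun i => X i ω) n (u m ω) k •
        h (u k ω) (X k ω) - ∫ y in 𝒳, h (u m ω) y ∂μ‖ ≤ ε := by
  have hlln : ∀ᵐ ω ∂P, ∀ i : ℕ, ∀ᶠ n : ℕ in atTop, ∀ v ∈ U,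
      ‖((n : ℝ) + 1)⁻¹ • ∑ i ∈ Finset.range (n + 1), h v (X i ω) - ∫ y in 𝒳, h v y ∂μ‖ ≤
        1 / ((i : ℝ) + 1) := ae_all_iff.2 fun i =>
    ae_eventually_empirical_mean_sub_le hU hS hS𝒳 h𝒳 hμS hh hX hX𝒳 hind hlaw hXS (by positivity)
  filter_upwards [hlln, hdense, hXS] with ω h1 h2 h3 ε hε
  obtain ⟨i, hi⟩ := exists_nat_one_div_lt (half_pos hε)
  obtain ⟨δ, hδ, hmod⟩ := exists_uniform_modulus hU hS hS𝒳 hh (half_pos hε)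
  obtain ⟨N, hN⟩ := exists_uniform_density hU hS (fun n => huU n ω) h2 (half_pos hδ)
  filter_upwards [h1 i, eventually_ge_atTop N] with n hn hnN m hm
  have := norm_sum_weight_sub_le (n := n) hS hS𝒳 h𝒳 hμS hh rule (fun i => huU i ω) h3 (huU m ω)
    hmod fun y hy => by
      obtain ⟨k, hk, hlt⟩ := hN m (hnN.trans hm) y hy
      exact ⟨k, by omega, hlt⟩
  linarith [hn (u m ω) (huU m ω)]

end Approximation

/-! ### Projected gradient steps with asymptotically exact data -/

section ProjectedGradient

variable {E : Type*} [NormedAddCommGroup E] [InnerProductSpace ℝ E] {U : Set E} {f : E → ℝ}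
  {h g' : E → E} {u G : ℕ → E} {τ : ℕ → ℝ} {τmin τmax τ₀ L c₁ : ℝ} {K : ℕ} {a a' : ℕ → ℝ}

/-- Limits of projected gradient iterates with vanishing steps and asymptotically exact gradients
are stationary. -/
theorem mem_stationaryPoints_of_tendsto (hU : IsCompact U) (hUc : Convex ℝ U)
    (hf : IsGradientOn U f h) (hf' : IsGradientOn U f g') (hcont : ContinuousOn h U)
    (huU : ∀ n, u n ∈ U) (hu : ∀ n, u (n + 1) = proj U (u n - τ n • G n))
    (hτmin : 0 < τmin) (hτ : ∀ n, τmin ≤ τ n)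
    (hG : Tendsto (fun n => ‖G n - g' (u n)‖) atTop (𝓝 0)) {φ : ℕ → ℕ}
    (hφ : Tendsto φ atTop atTop) {p : E} (hp : Tendsto (u ∘ φ) atTop (𝓝 p))
    (hstep : Tendsto (fun k => ‖u (φ k + 1) - u (φ k)‖) atTop (𝓝 0)) :
    p ∈ stationaryPoints U h := by
  have hpU : p ∈ U := hU.isClosed.mem_of_tendsto hp (Eventually.of_forall fun k => huU _)
  refine (mem_stationaryPoints_iff hU hUc).2 ⟨hpU, fun v hv => ?_⟩
  obtain ⟨D, hD0, hD⟩ : ∃ D, 0 ≤ D ∧ ∀ v ∈ U, ∀ w ∈ U, ‖v - w‖ ≤ D :=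
    ⟨Metric.diam U, Metric.diam_nonneg, fun v hv w hw =>
      dist_eq_norm v w ▸ Metric.dist_le_diam_of_mem hU.isBounded hv hw⟩
  have hlow : ∀ n, -(‖u (n + 1) - u n‖ * D / τmin) - ‖G n - g' (u n)‖ * D ≤
      inner ℝ (h (u n)) (v - u (n + 1)) := by
    intro n
    have h1 := inner_step_le hU hUc (u := u n) (G := G n) (t := τ n) hv
    rw [← hu n] at h1
    have h2 := neg_le_of_abs_le (abs_real_inner_le_norm (u n - u (n + 1)) (v - u (n + 1)))
    have h3 : ‖u n - u (n + 1)‖ * ‖v - u (n + 1)‖ ≤ ‖u (n + 1) - u n‖ * D := by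
      rw [norm_sub_rev]
      exact mul_le_mul_of_nonneg_left (hD _ hv _ (huU _)) (norm_nonneg _)
    have h4 : -(‖u (n + 1) - u n‖ * D / τmin) ≤ inner ℝ (G n) (v - u (n + 1)) := by
      rw [neg_le, le_div_iff₀ hτmin]
      -- Only a negative inner product needs an estimate, and there `τ n` may be replaced by `τmin`.
      rcases le_total 0 (inner ℝ (G n) (v - u (n + 1))) with h0 | h0
      · have : 0 ≤ ‖u (n + 1) - u n‖ * D := by positivity
        nlinarith
      · nlinarith [hτ n]
    have h5 := neg_le_of_abs_le (abs_real_inner_le_norm (g' (u n) - G n) (v - u (n + 1)))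
    have h6 : ‖g' (u n) - G n‖ * ‖v - u (n + 1)‖ ≤ ‖G n - g' (u n)‖ * D := by
      rw [norm_sub_rev]
      exact mul_le_mul_of_nonneg_left (hD _ hv _ (huU _)) (norm_nonneg _)
    rw [hf.inner_sub_eq hUc hf' (huU n) hv (huU (n + 1))]
    rw [inner_sub_left] at h5
    linarith
  have hnext : Tendsto (fun k => u (φ k + 1)) atTop (𝓝 p) := by
    have := hp.add (tendsto_zero_iff_norm_tendsto_zero.2 hstep)
    simpa using this
  have hh : Tendsto (fun k => h (u (φ k))) atTop (𝓝 (h p)) := (hcont p hpU).tendsto.comp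
    (tendsto_nhdsWithin_iff.2 ⟨hp, Eventually.of_forall fun k => huU _⟩)
  have hl : Tendsto (fun k => -(‖u (φ k + 1) - u (φ k)‖ * D / τmin) -
      ‖G (φ k) - g' (u (φ k))‖ * D) atTop (𝓝 0) := by
    simpa using (((hstep.mul_const D).div_const τmin).neg).sub ((hG.comp hφ).mul_const D)
  exact le_of_tendsto_of_tendsto' hl (hh.inner (tendsto_const_nhds.sub hnext)) fun k => hlow (φ k)

/-- The decrease of the values along projected gradient iterates with asymptotically exact
gradients and values, if each step satisfies the Armijo condition or is short. -/
theorem exists_descent_errors (hU : IsCompact U) (hUc : Convex ℝ U)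
    (hf : IsGradientOn U f h) (hf' : IsGradientOn U f g') (hL : 0 < L)
    (hlip : ∀ u ∈ U, ∀ v ∈ U, ‖h u - h v‖ ≤ L * ‖u - v‖)
    (huU : ∀ n, u n ∈ U) (hu : ∀ n, u (n + 1) = proj U (u n - τ n • G n))
    (hτ0 : ∀ n, 0 < τ n) (hτ : ∀ n, τ n ≤ τmax) (hτ₀L : τ₀ < 2 / L) (hc₁ : 0 < c₁)
    (hG : Tendsto (fun n => ‖G n - g' (u n)‖) atTop (𝓝 0))
    (ha : Tendsto (fun n => a n - f (u n)) atTop (𝓝 0))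
    (ha' : Tendsto (fun n => a' n - f (u (n + 1))) atTop (𝓝 0))
    (hstep : ∀ n, a' n ≤ windowMax a K n - c₁ * inner ℝ (G n) (u n - u (n + 1)) ∨ τ n = τ₀) :
    ∃ c > 0, ∃ e : ℕ → ℝ, Tendsto e atTop (𝓝 0) ∧ ∀ n, f (u (n + 1)) ≤
      windowMax (fun i => f (u i)) K n - c * ‖u (n + 1) - u n‖ ^ 2 + e n := by
  have hτmax : 0 < τmax := (hτ0 0).trans_le (hτ 0)
  -- The first bound serves Armijo steps, the second short ones; `1 / τ₀ - L / 2 > 0` is exactly `τ₀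
  -- < 2 / L`.
  obtain ⟨c, hc, hcτ, hcL⟩ : ∃ c > 0, c ≤ c₁ / τmax ∧ (0 < τ₀ → c ≤ 1 / τ₀ - L / 2) := by
    by_cases h0 : 0 < τ₀
    · have h1 : 0 < 1 / τ₀ - L / 2 := by
        rw [sub_pos, div_lt_div_iff₀ two_pos h0]
        rw [lt_div_iff₀ hL] at hτ₀L
        linarith
      exact ⟨min (c₁ / τmax) (1 / τ₀ - L / 2), lt_min (by positivity) h1, min_le_left _ _,
        fun _ => min_le_right _ _⟩
    · exact ⟨c₁ / τmax, by positivity, le_rfl, fun h => absurd h h0⟩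
  -- The error is defined as the positive part of what is missing, so only its convergence to zero
  -- needs proof.
  refine ⟨c, hc, fun n => max 0 (f (u (n + 1)) - windowMax (fun i => f (u i)) K n +
    c * ‖u (n + 1) - u n‖ ^ 2), ?_, fun n => ?_⟩
  swap
  · linarith [le_max_right 0 (f (u (n + 1)) - windowMax (fun i => f (u i)) K n +
      c * ‖u (n + 1) - u n‖ ^ 2)]
  obtain ⟨D, hD0, hD⟩ : ∃ D, 0 ≤ D ∧ ∀ v ∈ U, ∀ w ∈ U, ‖v - w‖ ≤ D :=
    ⟨Metric.diam U, Metric.diam_nonneg, fun v hv w hw =>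
      dist_eq_norm v w ▸ Metric.dist_le_diam_of_mem hU.isBounded hv hw⟩
  have hGD : Tendsto (fun n => ‖G n - g' (u n)‖ * D) atTop (𝓝 0) := by
    simpa using hG.mul_const D
  rw [tendsto_order]
  refine ⟨fun b hb => Eventually.of_forall fun n => hb.trans_le (le_max_left _ _), fun ε hε => ?_⟩
  obtain ⟨N, hN⟩ := eventually_atTop.1 (Metric.tendsto_nhds.1 ha (ε / 2) (half_pos hε))
  -- From `N + K` on, the whole window lies where the values are accurate.
  filter_upwards [eventually_ge_atTop (N + K), Metric.tendsto_nhds.1 ha' (ε / 2) (half_pos hε),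
    hGD.eventually (gt_mem_nhds hε)] with n hn ha'n hGn
  refine max_lt hε ?_
  have hr : ‖u (n + 1) - u n‖ ^ 2 ≤ τ n * inner ℝ (G n) (u n - u (n + 1)) := by
    have h1 := inner_step_le hU hUc (u := u n) (G := G n) (t := τ n) (huU n)
    rwa [← hu n, real_inner_self_eq_norm_sq, norm_sub_rev] at h1
  have hr0 : 0 ≤ ‖u (n + 1) - u n‖ ^ 2 := by positivity
  rcases hstep n with hA | hτn
  · have hwin : windowMax a K n ≤ windowMax (fun i => f (u i)) K n + ε / 2 := by
      refine windowMax_le a fun m hm hmK => ?_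
      have h1 := (abs_lt.1 (by simpa [Real.dist_eq] using hN m (by omega) :
        |a m - f (u m)| < ε / 2)).2
      have h2 : f (u m) ≤ _ := le_windowMax (fun i => f (u i)) hm hmK
      linarith
    have h1 := (abs_lt.1 (by simpa [Real.dist_eq] using ha'n :
      |a' n - f (u (n + 1))| < ε / 2)).1
    have h2 : 0 ≤ inner ℝ (G n) (u n - u (n + 1)) :=
      nonneg_of_mul_nonneg_right (hr0.trans hr) (hτ0 n)
    have h3 : ‖u (n + 1) - u n‖ ^ 2 ≤ τmax * inner ℝ (G n) (u n - u (n + 1)) :=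
      hr.trans (mul_le_mul_of_nonneg_right (hτ n) h2)
    have h4 : c * ‖u (n + 1) - u n‖ ^ 2 ≤ c₁ * inner ℝ (G n) (u n - u (n + 1)) := by
      calc c * ‖u (n + 1) - u n‖ ^ 2
          ≤ c₁ / τmax * (τmax * inner ℝ (G n) (u n - u (n + 1))) := by gcongr
        _ = _ := by field_simp
    linarith
  · have hτ₀ : 0 < τ₀ := hτn ▸ hτ0 n
    rw [hτn] at hr
    have h1 := hf.le_add_sq hUc hlip (huU n) (huU (n + 1))
    rw [hf.inner_sub_eq hUc hf' (huU n) (huU (n + 1)) (huU n)] at h1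
    have h2 := real_inner_le_norm (g' (u n) - G n) (u (n + 1) - u n)
    have h3 : ‖g' (u n) - G n‖ * ‖u (n + 1) - u n‖ ≤ ‖G n - g' (u n)‖ * D := by
      rw [norm_sub_rev]
      exact mul_le_mul_of_nonneg_left (hD _ (huU _) _ (huU _)) (norm_nonneg _)
    rw [inner_sub_left] at h2
    have h4 : 1 / τ₀ * ‖u (n + 1) - u n‖ ^ 2 ≤ - inner ℝ (G n) (u (n + 1) - u n) := by
      rw [← inner_neg_right, neg_sub, one_div, inv_mul_le_iff₀ hτ₀]
      exact hr
    have h5 := mul_le_mul_of_nonneg_right (hcL hτ₀) hr0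
    have h6 : f (u n) ≤ _ := le_windowMax (fun i => f (u i)) (K := K) le_rfl (Nat.le_add_right n K)
    linarith

/-- Convergence of projected gradient iterates with asymptotically exact gradients and values, if
each step satisfies the Armijo condition or is short and the stationary values form a null set. -/
theorem projectedGradient_converges (hU : IsCompact U) (hUc : Convex ℝ U)
    (hf : IsGradientOn U f h) (hf' : IsGradientOn U f g') (hL : 0 < L)
    (hlip : ∀ u ∈ U, ∀ v ∈ U, ‖h u - h v‖ ≤ L * ‖u - v‖)
    (huU : ∀ n, u n ∈ U) (hu : ∀ n, u (n + 1) = proj U (u n - τ n • G n))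
    (hτmin : 0 < τmin) (hτ : ∀ n, τmin ≤ τ n ∧ τ n ≤ τmax) (hτ₀L : τ₀ < 2 / L) (hc₁ : 0 < c₁)
    (hG : Tendsto (fun n => ‖G n - g' (u n)‖) atTop (𝓝 0))
    (ha : Tendsto (fun n => a n - f (u n)) atTop (𝓝 0))
    (ha' : Tendsto (fun n => a' n - f (u (n + 1))) atTop (𝓝 0))
    (hstep : ∀ n, a' n ≤ windowMax a K n - c₁ * inner ℝ (G n) (u n - u (n + 1)) ∨ τ n = τ₀)
    (hnull : volume (f '' stationaryPoints U h) = 0) :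
    (∀ p, MapClusterPt p atTop u → p ∈ stationaryPoints U h) ∧
      (∃ ℓ, Tendsto (fun n => f (u n)) atTop (𝓝 ℓ)) ∧
      Tendsto (fun n => ‖u (n + 1) - u n‖) atTop (𝓝 0) := by
  have hcont : ContinuousOn h U := by
    refine LipschitzOnWith.continuousOn (K := L.toNNReal) (LipschitzOnWith.of_dist_le_mul ?_)
    intro v hv w hw
    rw [dist_eq_norm, dist_eq_norm, Real.coe_toNNReal L hL.le]
    exact hlip v hv w hw
  have hstat : ∀ φ : ℕ → ℕ, Tendsto φ atTop atTop → ∀ p, Tendsto (u ∘ φ) atTop (𝓝 p) →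
      Tendsto (fun k => ‖u (φ k + 1) - u (φ k)‖) atTop (𝓝 0) → p ∈ stationaryPoints U h :=
    fun φ hφ p hp hs => mem_stationaryPoints_of_tendsto hU hUc hf hf' hcont huU hu hτmin
      (fun n => (hτ n).1) hG hφ hp hs
  obtain ⟨c, hc, e, he, hdesc⟩ := exists_descent_errors hU hUc hf hf' hL hlip huU hu
    (fun n => hτmin.trans_le (hτ n).1) (fun n => (hτ n).2) hτ₀L hc₁ hG ha ha' hstep
  have hSU : stationaryPoints U h ⊆ U := fun _ hv => hv.1
  have hSc : IsClosed (f '' stationaryPoints U h) :=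
    ((hU.of_isClosed_subset (isClosed_stationaryPoints hU hUc hcont) hSU).image_of_continuousOn
      (hf.continuousOn.mono hSU)).isClosed
  obtain ⟨h1, h2⟩ := tendsto_value_and_step hU hf.continuousOn huU hc he hdesc hstat hSc hnull
  refine ⟨fun p hp => ?_, h1, h2⟩
  obtain ⟨φ, hφ, hlim⟩ := hp.tendsto_subseq
  exact hstat φ hφ.tendsto_atTop p hlim (h2.comp hφ.tendsto_atTop)

end ProjectedGradient

theorem tendsto_zero_of_eventually_le {H : Type*} [SeminormedAddCommGroup H] {b : ℕ → H}
    (hb : ∀ ε > 0, ∀ᶠ n in atTop, ‖b n‖ ≤ ε) : Tendsto b atTop (𝓝 0) := by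
  refine Metric.tendsto_nhds.2 fun ε hε => ?_
  filter_upwards [hb (ε / 2) (half_pos hε)] with n hn
  rw [dist_zero_right]
  linarith

end CSG

end

/-! ### Assembly of the main theorem -/

theorem mainTheorem3
    {E F Ω : Type*}
    [NormedAddCommGroup E] [InnerProductSpace ℝ E] [FiniteDimensional ℝ E]
    [NormedAddCommGroup F] [NormedSpace ℝ F] [FiniteDimensional ℝ F]
    [MeasurableSpace F] [BorelSpace F]
    [MeasurableSpace Ω] (P : Measure Ω) [IsProbabilityMeasure P]
    -- the admissible set, the parameter set and the distribution of the parameter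
    (U : Set E) (hU_compact : IsCompact U) (hU_convex : Convex ℝ U)
    (𝒳 : Set F) (h𝒳_open : IsOpen 𝒳) (h𝒳_bdd : Bornology.IsBounded 𝒳)
    (μ : Measure F) [IsProbabilityMeasure μ] (hμ_supp : μ.support ⊆ 𝒳)
    -- the integrand and its gradient with respect to the first argument
    (j : E → F → ℝ) (g : E → F → E)
    (hj_cont : ContinuousOn (Function.uncurry j) (U ×ˢ 𝒳))
    (hg_cont : ContinuousOn (Function.uncurry g) (U ×ˢ 𝒳))
    (hg : ∀ x ∈ 𝒳, CSG.IsGradientOn U (fun u => j u x) (fun u => g u x))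
    -- the objective function is `L`-smooth with gradient `gradJ`
    (gradJ : E → E) (hgradJ : CSG.IsGradientOn U (CSG.objective μ 𝒳 j) gradJ)
    (L : ℝ) (hL : 0 < L)
    (hgradJ_lip : ∀ u ∈ U, ∀ v ∈ U, ‖gradJ u - gradJ v‖ ≤ L * ‖u - v‖)
    -- independent samples with distribution `μ`
    (X : ℕ → Ω → F) (hX_meas : ∀ n, Measurable (X n)) (hX_mem : ∀ n ω, X n ω ∈ 𝒳)
    (hX_indep : iIndepFun X P) (hX_law : ∀ n, P.map (X n) = μ)
    -- the backtracking CSG method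
    (rule : CSG.WeightRule) (ls : CSG.LineSearch)
    (hc₁ : 0 < ls.c₁) (hc₁₂ : ls.c₁ < ls.c₂) (hc₂ : ls.c₂ < 1)
    (hη : 0 < ls.η) (hT : ls.η / 2 ^ ls.T < 2 / L)
    (u₀ : E) (hu₀ : u₀ ∈ U)
    (u : ℕ → Ω → E)
    (hu : ∀ ω, CSG.IsBacktrackingCSG rule μ U j g ls u₀ (fun n => X n ω) (fun n => u n ω)) :
    (volume (CSG.objective μ 𝒳 j '' CSG.stationaryPoints U gradJ) = 0 →
      ∀ᵐ ω ∂P,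
        (∀ p : E, MapClusterPt p atTop (fun n => u n ω) → p ∈ CSG.stationaryPoints U gradJ) ∧
        ∃ ℓ : ℝ, Tendsto (fun n => CSG.objective μ 𝒳 j (u n ω)) atTop (𝓝 ℓ)) ∧
    ((CSG.stationaryPoints U gradJ).Finite →
      ∀ᵐ ω ∂P, ∃ p ∈ CSG.stationaryPoints U gradJ,
        Tendsto (fun n => u n ω) atTop (𝓝 p)) := by
  open CSG in
  have : ProperSpace F := FiniteDimensional.proper ℝ F
  have : ProperSpace E := FiniteDimensional.proper ℝ E
  have : CompleteSpace E := FiniteDimensional.complete ℝ E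
  borelize E
  have hS : IsCompact μ.support :=
    Metric.isCompact_of_isClosed_isBounded Measure.isClosed_support (h𝒳_bdd.subset hμ_supp)
  have hμS : ∀ᵐ y ∂μ, y ∈ μ.support := Measure.support_mem_ae
  have hXS : ∀ᵐ ω ∂P, ∀ n, X n ω ∈ μ.support := ae_all_iff.2 fun n =>
    ae_of_ae_map (hX_meas n).aemeasurable ((hX_law n).symm ▸ hμS)
  have huU : ∀ n ω, u n ω ∈ U := fun n ω => (hu ω).mem hU_compact hU_convex hu₀ n
  have hum : ∀ n, Measurable[pastFiltration hX_meas n] (u n) := fun n =>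
    measurable_iterate hU_compact hU_convex hu₀ hj_cont hg_cont hX_mem hu n _
      fun i hi => measurable_pastFiltration hX_meas hi
  have hdense := ae_mapClusterPt_prod hX_meas hX_indep hX_law hum
  have hval := ae_eventually_sum_weight_sub_le hU_compact hS hμ_supp h𝒳_open hμS hj_cont hX_meas
    hX_mem hX_indep hX_law hXS rule huU hdense
  have hgrd := ae_eventually_sum_weight_sub_le hU_compact hS hμ_supp h𝒳_open hμS hg_cont hX_meas
    hX_mem hX_indep hX_law hXS rule huU hdense
  -- The search directions approximate this integral field, while the Lipschitz bound concerns
  -- `gradJ`; the two agree along `U`, which suffices.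
  have hgradI := isGradientOn_objective hU_compact hU_convex hS hμ_supp h𝒳_open hμS hj_cont hg_cont hg
  have key : volume (objective μ 𝒳 j '' stationaryPoints U gradJ) = 0 → ∀ᵐ ω ∂P,
      (∀ p : E, MapClusterPt p atTop (fun n => u n ω) → p ∈ stationaryPoints U gradJ) ∧
      (∃ ℓ : ℝ, Tendsto (fun n => objective μ 𝒳 j (u n ω)) atTop (𝓝 ℓ)) ∧
      Tendsto (fun n => ‖u (n + 1) ω - u n ω‖) atTop (𝓝 0) := by
    intro hnull
    filter_upwards [hval, hgrd] with ω hvω hgω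
    refine projectedGradient_converges (K := ls.K) (c₁ := ls.c₁) (τ₀ := ls.η / 2 ^ ls.T)
      (τmin := ls.η / 2 ^ ls.T) (τmax := ls.η * 2 ^ ls.T)
      (τ := fun n => stepSize rule μ U j g ls (fun n => u n ω) (fun n => X n ω) n)
      (G := fun n => gradApprox rule μ g (fun n => u n ω) (fun n => X n ω) n (u n ω))
      (a := fun n => valueApprox rule μ j (fun n => u n ω) (fun n => X n ω) n (u n ω))
      (a' := fun n => valueApprox rule μ j (fun n => u n ω) (fun n => X n ω) n (u (n + 1) ω))
      hU_compact hU_convex hgradJ hgradI hL hgradJ_lip (fun n => huU n ω) (hu ω).2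
      (by positivity) (fun n => ?_) hT hc₁ ?_ ?_ ?_ (fun n => ?_) hnull
    · exact backtrack_bounds ls.T 0 none none ls.η ls.η ls.η hη.le le_rfl hη.le
        (by rintro s ⟨⟩) (by rintro s ⟨⟩) le_rfl le_rfl
    · rw [← tendsto_zero_iff_norm_tendsto_zero]
      refine tendsto_zero_of_eventually_le fun ε hε => ?_
      filter_upwards [hgω ε hε] with n hn using hn n le_rfl
    · refine tendsto_zero_of_eventually_le fun ε hε => ?_
      filter_upwards [hvω ε hε] with n hn using hn n le_rfl
    · refine tendsto_zero_of_eventually_le fun ε hε => ?_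
      -- The Armijo test evaluates the time-`n` model at the next iterate; this is why consistency
      -- is uniform in `m ≥ n`.
      filter_upwards [hvω ε hε] with n hn using hn (n + 1) n.le_succ
    · refine (backtrack_none (A := Armijo rule μ U j g ls (fun n => u n ω) (fun n => X n ω) n)
        ls.T none ls.η).imp_left fun hA => ?_
      have hnext : u (n + 1) ω = trial rule μ U g (fun n => u n ω) (fun n => X n ω) n
          (stepSize rule μ U j g ls (fun n => u n ω) (fun n => X n ω) n) := (hu ω).2 n
      rw [hnext]
      exact hA
  refine ⟨fun hnull => (key hnull).mono fun ω hω => ⟨hω.1, hω.2.1⟩, fun hfin => ?_⟩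
  filter_upwards [key ((hfin.image _).measure_zero _)] with ω hω
  exact exists_tendsto_of_finite_clusterPts hU_compact (fun n => huU n ω) hω.2.2 hfin hω.1
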